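/- Let $\mathsf A$ be a category with finite colimits and let $F:(\mathsf A,+)\to(\mathbf{Cat},\times)$ be a lax monoidal functor, with laxators $F_{m,n}:F(m)\times F(n)\to F(m+n)$ and unitor $F_0:\mathbf 1\to F(0)$. Double categories are pseudo double categories (external composition is associative and unital up to coherent globular isomorphism). For composable cospans $p=(a\to m\leftarrow b)$ and $q=(b\to n\leftarrow c)$ in $\mathsf A$, let $p\odot q=(a\to m+_b n\leftarrow c)$ be their composite by pushout, let $\iota_m,\iota_n$ be the inclusions of $m,n$ into $m+_bn$, and let $$\Phi_{m,n}:\ F(m)\times F(n)\xrightarrow{F_{m,n}}F(m+n)\xrightarrow{F([\iota_m,\iota_n])}F(m+_bn).$$ For an object $a$ of $\mathsf A$ let $\Phi_a\in F(a)$ be the object picked out by $\mathbf 1\xrightarrow{F_0}F(0)\xrightarrow{F(!)}F(a)$. Then there is a double category $\mathbb{DC}\mathrm{sp}(F)$ with the following data. * The objects and arrows are the objects and morphisms of $\mathsf A$. * The proarrows $a\to b$ are the $F$-decorated cospans, i.e. the pairs $(p,s)$ of a cospan $p=(a\to m\leftarrow b)$ in $\mathsf A$ and an object $s\in F(m)$.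 * The cells $(p,s)\to(q,t)$ with boundary arrows $f:a\to c$ and $g:b\to d$, where $p=(a\to m\leftarrow b)$ and $q=(c\to n\leftarrow d)$, are the pairs of a morphism of cospans $(f,h,g):p\to q$, with $h:m\to n$, and a morphism $\nu:F(h)(s)\to t$ in $F(n)$. The internal identity and composition are $\bigl(\mathrm{id},\mathrm{id}_s\bigr)$ and $(h',\nu')\circ(h,\nu)=(h'h,\ \nu'\circ F(h')(\nu))$. * The external composite of $(p,s):a\to b$ and $(q,t):b\to c$ is $(p\odot q,\Phi_{m,n}(s,t))$, and that of cells $(\alpha,\mu)$ and $(\beta,\nu)$ whose bottom cospans have apexes $m'$ and $n'$ is $(\alpha\odot\beta,\Phi_{m',n'}(\mu,\nu))$. * The identity proarrow of $a$ is $(\mathrm{id}_a,\Phi_a)$, and the external identity cell on an arrow $f:a\to b$ is $(\mathrm{id}_f,\mathrm{id}_{\Phi_b})$. Its associators and unitors can be chosen so that the following hold. 1. The projection $\pi_F:\mathbb{DC}\mathrm{sp}(F)\to\mathbb{C}\mathrm{sp}(\mathsf A)$, which forgets decorations and decoration morphisms, is a strict double functor. 2. $\mathbb{DC}\mathrm{sp}(F)$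 is the double Grothendieck construction $\int\tilde F$ of the composite lax double functor $$\tilde F:\ \mathbb{C}\mathrm{sp}(\mathsf A)\longrightarrow\mathbb{M}\mathrm{on}(\mathsf A,+)\xrightarrow{\ F\ }\mathbb{M}\mathrm{on}(\mathbf{Cat},\times)\longrightarrow\mathbb{S}\mathrm{pan}(\mathbf{Cat}).$$ That is, the canonical map $a\mapsto(a,*)$, $f\mapsto(f,\mathrm{id}_*)$, $(p,s)\mapsto(p,s)$, $(\alpha,\nu)\mapsto(\alpha,\nu)$ is a strict double functor $\mathbb{DC}\mathrm{sp}(F)\to\int\tilde F$ that is bijective on objects, arrows, proarrows and cells, and it commutes with the projections to $\mathbb{C}\mathrm{sp}(\mathsf A)$. Here a monoidal category $\mathsf C$ is regarded as a double category $\mathbb{M}\mathrm{on}(\mathsf C)$ with trivial category of objects and arrows. The first double functor sends a cospan to its apex and has laxators $[\iota_m,\iota_n]:m+n\to m+_bn$ and unitors $!:0\to a$. The second is induced by $F$. The third sends a category $X$ to the span $\mathbf 1\leftarrow X\to\mathbf 1$. For a lax double functor $G:\mathbb D\to\mathbb{S}\mathrm{pan}(\mathbf{Cat})$, with $G(m)=(G(a)\xleftarrow{\sigma_m}\operatorname{apex}G(m)\xrightarrow{\tau_m}G(b))$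 for a proarrow $m:a\to b$, the double category $\int G$ has * objects $(a,x)$ with $x\in G(a)$; * arrows $(f,\phi):(a,x)\to(b,y)$ with $\phi:G(f)(x)\to y$; * proarrows $(m,s):(a,x)\to(b,y)$ with $s\in\operatorname{apex}G(m)$, $\sigma_m(s)=x$ and $\tau_m(s)=y$; * cells $(\alpha,\nu):(m,s)\to(n,t)$ with $\nu:\operatorname{apex}G(\alpha)(s)\to t$, whose boundary arrows have second components $\sigma_n(\nu)$ and $\tau_n(\nu)$; * external composition and identities given by those of $\mathbb D$ and by the laxators and unitors of $G$, and associators and unitors given by those of $\mathbb D$ together with identity morphisms of decorations. -/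

import Mathlib

open CategoryTheory Limits MonoidalCategory

universe u₁ v₁ u₂ v₂ u₁' v₁' u₂' v₂' u₁'' v₁'' u₂'' v₂'' v u

namespace Dbl

/-! ## Double categories -/

/-- The data of a double category apart from the associators and unitors: a category of objects and
arrows, proarrows, cells, and the operations on them. A cell `α : Cell m n` has its boundary arrows
as data, `left α` and `right α`, so `Cell m n` is the hom-type of `m` and `n` in the category of
proarrows and cells, and `left`, `right` are the source and target functors on morphisms. -/
structure DoubleData where
  /-- objects -/
  Obj : Type u₁
  /-- arrows -/
  [cat : Category.{v₁} Obj]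
  /-- proarrows -/
  Pro : Obj → Obj → Type u₂
  /-- cells with given top and bottom proarrows -/
  Cell : ∀ {a b c d : Obj}, Pro a b → Pro c d → Type v₂
  /-- left boundary of a cell -/
  left : ∀ {a b c d : Obj} {m : Pro a b} {n : Pro c d}, Cell m n → (a ⟶ c)
  /-- right boundary of a cell -/
  right : ∀ {a b c d : Obj} {m : Pro a b} {n : Pro c d}, Cell m n → (b ⟶ d)
  /-- internal identity cell -/
  vid : ∀ {a b : Obj} (m : Pro a b), Cell m m
  /-- internal composition of cells -/
  vcomp : ∀ {a b c d e f : Obj} {m : Pro a b} {n : Pro c d} {p : Pro e f},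
    Cell m n → Cell n p → Cell m p
  /-- identity proarrow -/
  hid : ∀ a : Obj, Pro a a
  /-- external identity cell on an arrow -/
  hidCell : ∀ {a b : Obj}, (a ⟶ b) → Cell (hid a) (hid b)
  /-- external composition of proarrows -/
  hcomp : ∀ {a b c : Obj}, Pro a b → Pro b c → Pro a c
  /-- external composition of cells -/
  hcompCell : ∀ {a b c a' b' c' : Obj} {m : Pro a b} {n : Pro b c} {m' : Pro a' b'}
    {n' : Pro b' c'} (α : Cell m m') (β : Cell n n'), right α = left β →
    Cell (hcomp m n) (hcomp m' n')

attribute [instance] DoubleData.cat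

namespace DoubleData

/-- A globular isomorphism between parallel proarrows: an invertible cell whose boundary arrows are
identities. -/
structure GlobIso (D : DoubleData.{u₁, v₁, u₂, v₂}) {a b : D.Obj} (m n : D.Pro a b) where
  /-- the cell -/
  hom : D.Cell m n
  /-- the inverse cell -/
  inv : D.Cell n m
  left_hom : D.left hom = 𝟙 a
  right_hom : D.right hom = 𝟙 b
  hom_inv : D.vcomp hom inv = D.vid m
  inv_hom : D.vcomp inv hom = D.vid n

end DoubleData

open DoubleData

/-- A (pseudo) double category: proarrows and cells form a category, source, target, external
identity and external composition are functorial, and external composition is associative and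
unital up to coherent natural globular isomorphism. -/
class DoubleCategory (D : DoubleData.{u₁, v₁, u₂, v₂}) where
  left_vid : ∀ {a b : D.Obj} (m : D.Pro a b), D.left (D.vid m) = 𝟙 a
  right_vid : ∀ {a b : D.Obj} (m : D.Pro a b), D.right (D.vid m) = 𝟙 b
  left_vcomp : ∀ {a b c d e f : D.Obj} {m : D.Pro a b} {n : D.Pro c d} {p : D.Pro e f}
    (α : D.Cell m n) (β : D.Cell n p), D.left (D.vcomp α β) = D.left α ≫ D.left β
  right_vcomp : ∀ {a b c d e f : D.Obj} {m : D.Pro a b} {n : D.Pro c d} {p : D.Pro e f}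
    (α : D.Cell m n) (β : D.Cell n p), D.right (D.vcomp α β) = D.right α ≫ D.right β
  vid_vcomp : ∀ {a b c d : D.Obj} {m : D.Pro a b} {n : D.Pro c d} (α : D.Cell m n),
    D.vcomp (D.vid m) α = α
  vcomp_vid : ∀ {a b c d : D.Obj} {m : D.Pro a b} {n : D.Pro c d} (α : D.Cell m n),
    D.vcomp α (D.vid n) = α
  vcomp_assoc : ∀ {a b c d e f g h : D.Obj} {m : D.Pro a b} {n : D.Pro c d} {p : D.Pro e f}
    {q : D.Pro g h} (α : D.Cell m n) (β : D.Cell n p) (γ : D.Cell p q),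
    D.vcomp (D.vcomp α β) γ = D.vcomp α (D.vcomp β γ)
  left_hidCell : ∀ {a b : D.Obj} (f : a ⟶ b), D.left (D.hidCell f) = f
  right_hidCell : ∀ {a b : D.Obj} (f : a ⟶ b), D.right (D.hidCell f) = f
  hidCell_id : ∀ a : D.Obj, D.hidCell (𝟙 a) = D.vid (D.hid a)
  hidCell_comp : ∀ {a b c : D.Obj} (f : a ⟶ b) (g : b ⟶ c),
    D.hidCell (f ≫ g) = D.vcomp (D.hidCell f) (D.hidCell g)
  left_hcompCell : ∀ {a b c a' b' c' : D.Obj} {m : D.Pro a b} {n : D.Pro b c} {m' : D.Pro a' b'}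
    {n' : D.Pro b' c'} (α : D.Cell m m') (β : D.Cell n n') (h : D.right α = D.left β),
    D.left (D.hcompCell α β h) = D.left α
  right_hcompCell : ∀ {a b c a' b' c' : D.Obj} {m : D.Pro a b} {n : D.Pro b c} {m' : D.Pro a' b'}
    {n' : D.Pro b' c'} (α : D.Cell m m') (β : D.Cell n n') (h : D.right α = D.left β),
    D.right (D.hcompCell α β h) = D.right β
  hcompCell_vid : ∀ {a b c : D.Obj} (m : D.Pro a b) (n : D.Pro b c),
    D.hcompCell (D.vid m) (D.vid n) ((right_vid m).trans (left_vid n).symm) = D.vid (D.hcomp m n)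
  /-- interchange law -/
  hcompCell_vcomp : ∀ {a b c a' b' c' a'' b'' c'' : D.Obj} {m : D.Pro a b} {n : D.Pro b c}
    {m' : D.Pro a' b'} {n' : D.Pro b' c'} {m'' : D.Pro a'' b''} {n'' : D.Pro b'' c''}
    (α : D.Cell m m') (β : D.Cell n n') (α' : D.Cell m' m'') (β' : D.Cell n' n'')
    (h : D.right α = D.left β) (h' : D.right α' = D.left β'),
    D.hcompCell (D.vcomp α α') (D.vcomp β β')
      ((right_vcomp α α').trans ((congrArg₂ (· ≫ ·) h h').trans (left_vcomp β β').symm)) =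
      D.vcomp (D.hcompCell α β h) (D.hcompCell α' β' h')
  /-- associators -/
  associator : ∀ {a b c d : D.Obj} (m : D.Pro a b) (n : D.Pro b c) (p : D.Pro c d),
    D.GlobIso (D.hcomp (D.hcomp m n) p) (D.hcomp m (D.hcomp n p))
  /-- left unitors -/
  leftUnitor : ∀ {a b : D.Obj} (m : D.Pro a b), D.GlobIso (D.hcomp (D.hid a) m) m
  /-- right unitors -/
  rightUnitor : ∀ {a b : D.Obj} (m : D.Pro a b), D.GlobIso (D.hcomp m (D.hid b)) m
  associator_naturality : ∀ {a b c d a' b' c' d' : D.Obj} {m : D.Pro a b} {n : D.Pro b c}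
    {p : D.Pro c d} {m' : D.Pro a' b'} {n' : D.Pro b' c'} {p' : D.Pro c' d'} (α : D.Cell m m')
    (β : D.Cell n n') (γ : D.Cell p p') (h : D.right α = D.left β) (k : D.right β = D.left γ),
    D.vcomp (D.hcompCell (D.hcompCell α β h) γ ((right_hcompCell α β h).trans k))
      (associator m' n' p').hom =
    D.vcomp (associator m n p).hom
      (D.hcompCell α (D.hcompCell β γ k) (h.trans (left_hcompCell β γ k).symm))
  leftUnitor_naturality : ∀ {a b c d : D.Obj} {m : D.Pro a b} {n : D.Pro c d} (α : D.Cell m n),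
    D.vcomp (D.hcompCell (D.hidCell (D.left α)) α (right_hidCell _)) (leftUnitor n).hom =
    D.vcomp (leftUnitor m).hom α
  rightUnitor_naturality : ∀ {a b c d : D.Obj} {m : D.Pro a b} {n : D.Pro c d} (α : D.Cell m n),
    D.vcomp (D.hcompCell α (D.hidCell (D.right α)) (left_hidCell _).symm) (rightUnitor n).hom =
    D.vcomp (rightUnitor m).hom α
  pentagon : ∀ {a b c d e : D.Obj} (m : D.Pro a b) (n : D.Pro b c) (p : D.Pro c d) (q : D.Pro d e),
    D.vcomp (D.hcompCell (associator m n p).hom (D.vid q)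
        ((associator m n p).right_hom.trans (left_vid q).symm))
      (D.vcomp (associator m (D.hcomp n p) q).hom
        (D.hcompCell (D.vid m) (associator n p q).hom
          ((right_vid m).trans (associator n p q).left_hom.symm))) =
    D.vcomp (associator (D.hcomp m n) p q).hom (associator m n (D.hcomp p q)).hom
  triangle : ∀ {a b c : D.Obj} (m : D.Pro a b) (n : D.Pro b c),
    D.vcomp (associator m (D.hid b) n).hom
      (D.hcompCell (D.vid m) (leftUnitor n).hom
        ((right_vid m).trans (leftUnitor n).left_hom.symm)) =
    D.hcompCell (rightUnitor m).hom (D.vid n) ((rightUnitor m).right_hom.trans (left_vid n).symm)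

/-! ## Double functors -/

/-- The underlying assignments of a double functor on objects, arrows, proarrows and cells. -/
structure DoubleMap (D : DoubleData.{u₁, v₁, u₂, v₂}) (E : DoubleData.{u₁', v₁', u₂', v₂'}) where
  /-- action on objects -/
  obj : D.Obj → E.Obj
  /-- action on arrows -/
  map : ∀ {a b : D.Obj}, (a ⟶ b) → (obj a ⟶ obj b)
  /-- action on proarrows -/
  pro : ∀ {a b : D.Obj}, D.Pro a b → E.Pro (obj a) (obj b)
  /-- action on cells -/
  cell : ∀ {a b c d : D.Obj} {m : D.Pro a b} {n : D.Pro c d}, D.Cell m n → E.Cell (pro m) (pro n)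

/-- Composition of the underlying assignments of double functors. -/
abbrev DoubleMap.comp {D : DoubleData.{u₁, v₁, u₂, v₂}} {E : DoubleData.{u₁', v₁', u₂', v₂'}}
    {K : DoubleData.{u₁'', v₁'', u₂'', v₂''}} (F : DoubleMap D E) (G : DoubleMap E K) :
    DoubleMap D K where
  obj a := G.obj (F.obj a)
  map f := G.map (F.map f)
  pro m := G.pro (F.pro m)
  cell α := G.cell (F.cell α)

/-- A double map that is functorial on arrows and on cells and respects the boundaries of cells. -/
structure DoubleMap.IsFunctorial {D : DoubleData.{u₁, v₁, u₂, v₂}}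
    {E : DoubleData.{u₁', v₁', u₂', v₂'}} (F : DoubleMap D E) : Prop where
  map_id : ∀ a : D.Obj, F.map (𝟙 a) = 𝟙 (F.obj a)
  map_comp : ∀ {a b c : D.Obj} (f : a ⟶ b) (g : b ⟶ c), F.map (f ≫ g) = F.map f ≫ F.map g
  left_cell : ∀ {a b c d : D.Obj} {m : D.Pro a b} {n : D.Pro c d} (α : D.Cell m n),
    E.left (F.cell α) = F.map (D.left α)
  right_cell : ∀ {a b c d : D.Obj} {m : D.Pro a b} {n : D.Pro c d} (α : D.Cell m n),
    E.right (F.cell α) = F.map (D.right α)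
  cell_vid : ∀ {a b : D.Obj} (m : D.Pro a b), F.cell (D.vid m) = E.vid (F.pro m)
  cell_vcomp : ∀ {a b c d e f : D.Obj} {m : D.Pro a b} {n : D.Pro c d} {p : D.Pro e f}
    (α : D.Cell m n) (β : D.Cell n p),
    F.cell (D.vcomp α β) = E.vcomp (F.cell α) (F.cell β)

/-- A lax double functor: a functorial double map with natural globular comparison cells
(laxators and unitors) that are coherent with the associators and unitors. -/
structure LaxDoubleFunctor (D : DoubleData.{u₁, v₁, u₂, v₂}) [DoubleCategory D]
    (E : DoubleData.{u₁', v₁', u₂', v₂'}) [DoubleCategory E] extends DoubleMap D E where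
  functorial : toDoubleMap.IsFunctorial
  /-- laxators -/
  lax : ∀ {a b c : D.Obj} (m : D.Pro a b) (n : D.Pro b c),
    E.Cell (E.hcomp (pro m) (pro n)) (pro (D.hcomp m n))
  left_lax : ∀ {a b c : D.Obj} (m : D.Pro a b) (n : D.Pro b c), E.left (lax m n) = 𝟙 (obj a)
  right_lax : ∀ {a b c : D.Obj} (m : D.Pro a b) (n : D.Pro b c), E.right (lax m n) = 𝟙 (obj c)
  /-- unitors -/
  unit : ∀ a : D.Obj, E.Cell (E.hid (obj a)) (pro (D.hid a))
  left_unit : ∀ a : D.Obj, E.left (unit a) = 𝟙 (obj a)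
  right_unit : ∀ a : D.Obj, E.right (unit a) = 𝟙 (obj a)
  lax_naturality : ∀ {a b c a' b' c' : D.Obj} {m : D.Pro a b} {n : D.Pro b c} {m' : D.Pro a' b'}
    {n' : D.Pro b' c'} (α : D.Cell m m') (β : D.Cell n n') (h : D.right α = D.left β)
    (h' : E.right (cell α) = E.left (cell β)),
    E.vcomp (lax m n) (cell (D.hcompCell α β h)) =
      E.vcomp (E.hcompCell (cell α) (cell β) h') (lax m' n')
  unit_naturality : ∀ {a b : D.Obj} (f : a ⟶ b),
    E.vcomp (unit a) (cell (D.hidCell f)) = E.vcomp (E.hidCell (map f)) (unit b)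
  lax_associativity : ∀ {a b c d : D.Obj} (m : D.Pro a b) (n : D.Pro b c) (p : D.Pro c d),
    E.vcomp (E.hcompCell (lax m n) (E.vid (pro p))
        ((right_lax m n).trans (DoubleCategory.left_vid _).symm))
      (E.vcomp (lax (D.hcomp m n) p) (cell (DoubleCategory.associator m n p).hom)) =
    E.vcomp (DoubleCategory.associator (pro m) (pro n) (pro p)).hom
      (E.vcomp (E.hcompCell (E.vid (pro m)) (lax n p)
        ((DoubleCategory.right_vid _).trans (left_lax n p).symm)) (lax m (D.hcomp n p)))
  lax_left_unitality : ∀ {a b : D.Obj} (m : D.Pro a b),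
    E.vcomp (E.hcompCell (unit a) (E.vid (pro m))
        ((right_unit a).trans (DoubleCategory.left_vid _).symm))
      (E.vcomp (lax (D.hid a) m) (cell (DoubleCategory.leftUnitor m).hom)) =
    (DoubleCategory.leftUnitor (pro m)).hom
  lax_right_unitality : ∀ {a b : D.Obj} (m : D.Pro a b),
    E.vcomp (E.hcompCell (E.vid (pro m)) (unit b)
        ((DoubleCategory.right_vid _).trans (left_unit b).symm))
      (E.vcomp (lax m (D.hid b)) (cell (DoubleCategory.rightUnitor m).hom)) =
    (DoubleCategory.rightUnitor (pro m)).hom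

/-- A double map is a strict double functor if it is functorial and preserves external identities,
external composition, associators and unitors on the nose. -/
structure DoubleMap.IsStrict {D : DoubleData.{u₁, v₁, u₂, v₂}} [DoubleCategory D]
    {E : DoubleData.{u₁', v₁', u₂', v₂'}} [DoubleCategory E] (F : DoubleMap D E) : Prop where
  functorial : F.IsFunctorial
  pro_hid : ∀ a : D.Obj, F.pro (D.hid a) = E.hid (F.obj a)
  cell_hidCell : ∀ {a b : D.Obj} (f : a ⟶ b), F.cell (D.hidCell f) ≍ E.hidCell (F.map f)
  pro_hcomp : ∀ {a b c : D.Obj} (m : D.Pro a b) (n : D.Pro b c),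
    F.pro (D.hcomp m n) = E.hcomp (F.pro m) (F.pro n)
  cell_hcompCell : ∀ {a b c a' b' c' : D.Obj} {m : D.Pro a b} {n : D.Pro b c} {m' : D.Pro a' b'}
    {n' : D.Pro b' c'} (α : D.Cell m m') (β : D.Cell n n') (h : D.right α = D.left β)
    (h' : E.right (F.cell α) = E.left (F.cell β)),
    F.cell (D.hcompCell α β h) ≍ E.hcompCell (F.cell α) (F.cell β) h'
  cell_associator : ∀ {a b c d : D.Obj} (m : D.Pro a b) (n : D.Pro b c) (p : D.Pro c d),
    F.cell (DoubleCategory.associator m n p).hom ≍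
      (DoubleCategory.associator (F.pro m) (F.pro n) (F.pro p)).hom
  cell_leftUnitor : ∀ {a b : D.Obj} (m : D.Pro a b),
    F.cell (DoubleCategory.leftUnitor m).hom ≍ (DoubleCategory.leftUnitor (F.pro m)).hom
  cell_rightUnitor : ∀ {a b : D.Obj} (m : D.Pro a b),
    F.cell (DoubleCategory.rightUnitor m).hom ≍ (DoubleCategory.rightUnitor (F.pro m)).hom

/-- An isomorphism of double categories: a strict double functor that is bijective on objects,
arrows, proarrows and cells. -/
structure DoubleMap.IsIsomorphism {D : DoubleData.{u₁, v₁, u₂, v₂}} [DoubleCategory D]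
    {E : DoubleData.{u₁', v₁', u₂', v₂'}} [DoubleCategory E] (F : DoubleMap D E) : Prop where
  strict : F.IsStrict
  bijective_obj : Function.Bijective F.obj
  bijective_map : ∀ a b : D.Obj, Function.Bijective (F.map : (a ⟶ b) → _)
  bijective_pro : ∀ a b : D.Obj, Function.Bijective (F.pro : D.Pro a b → _)
  bijective_cell : ∀ {a b c d : D.Obj} (m : D.Pro a b) (n : D.Pro c d),
    Function.Bijective (F.cell : D.Cell m n → _)

section Composition

variable {D : DoubleData.{u₁, v₁, u₂, v₂}} [DoubleCategory D]
  {E : DoubleData.{u₁', v₁', u₂', v₂'}} [DoubleCategory E]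
  {K : DoubleData.{u₁'', v₁'', u₂'', v₂''}} [DoubleCategory K]

/-- The interchange law with free choice of the composites. -/
theorem hcompCell_of_vcomp {a b c a' b' c' a'' b'' c'' : D.Obj} {m : D.Pro a b} {n : D.Pro b c}
    {m' : D.Pro a' b'} {n' : D.Pro b' c'} {m'' : D.Pro a'' b''} {n'' : D.Pro b'' c''}
    {A : D.Cell m m''} {B : D.Cell n n''} (H : D.right A = D.left B)
    {α : D.Cell m m'} {β : D.Cell n n'} {α' : D.Cell m' m''} {β' : D.Cell n' n''}
    (h : D.right α = D.left β) (h' : D.right α' = D.left β') (hA : A = D.vcomp α α')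
    (hB : B = D.vcomp β β') :
    D.hcompCell A B H = D.vcomp (D.hcompCell α β h) (D.hcompCell α' β' h') := by
  subst hA hB; exact DoubleCategory.hcompCell_vcomp _ _ _ _ _ _

theorem LaxDoubleFunctor.cell_compat (F : LaxDoubleFunctor D E) {a b c a' b' c' : D.Obj}
    {m : D.Pro a b} {n : D.Pro b c} {m' : D.Pro a' b'} {n' : D.Pro b' c'} {α : D.Cell m m'}
    {β : D.Cell n n'} (h : D.right α = D.left β) : E.right (F.cell α) = E.left (F.cell β) := by
  rw [F.functorial.right_cell, F.functorial.left_cell, h]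

open DoubleCategory in
/-- The composite of two lax double functors. Its laxator at `m`, `n` is the laxator of `G` at
`F m`, `F n` followed by the image under `G` of the laxator of `F`; similarly for unitors. -/
def LaxDoubleFunctor.comp (F : LaxDoubleFunctor D E) (G : LaxDoubleFunctor E K) :
    LaxDoubleFunctor D K where
  toDoubleMap := F.toDoubleMap.comp G.toDoubleMap
  functorial :=
    { map_id := fun a => by simp [F.functorial.map_id, G.functorial.map_id]
      map_comp := fun f g => by simp [F.functorial.map_comp, G.functorial.map_comp]
      left_cell := fun α => by simp [F.functorial.left_cell, G.functorial.left_cell]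
      right_cell := fun α => by simp [F.functorial.right_cell, G.functorial.right_cell]
      cell_vid := fun m => by simp [F.functorial.cell_vid, G.functorial.cell_vid]
      cell_vcomp := fun α β => by simp [F.functorial.cell_vcomp, G.functorial.cell_vcomp] }
  lax m n := K.vcomp (G.lax (F.pro m) (F.pro n)) (G.cell (F.lax m n))
  left_lax m n := by
    simp [left_vcomp, G.left_lax, G.functorial.left_cell, F.left_lax, G.functorial.map_id]
  right_lax m n := by
    simp [right_vcomp, G.right_lax, G.functorial.right_cell, F.right_lax, G.functorial.map_id]
  unit a := K.vcomp (G.unit (F.obj a)) (G.cell (F.unit a))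
  left_unit m := by
    simp [left_vcomp, G.left_unit, G.functorial.left_cell, F.left_unit, G.functorial.map_id]
  right_unit m := by
    simp [right_vcomp, G.right_unit, G.functorial.right_cell, F.right_unit, G.functorial.map_id]
  lax_naturality α β h h' := by
    rw [vcomp_assoc, ← G.functorial.cell_vcomp, F.lax_naturality α β h (F.cell_compat h),
      G.functorial.cell_vcomp, ← vcomp_assoc, G.lax_naturality _ _ _ h', vcomp_assoc]
  unit_naturality f := by
    rw [vcomp_assoc, ← G.functorial.cell_vcomp, F.unit_naturality,
      G.functorial.cell_vcomp, ← vcomp_assoc, G.unit_naturality, vcomp_assoc]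
  lax_associativity m n p := by
    have hL : E.right (F.lax m n) = E.left (E.vid (F.pro p)) :=
      (F.right_lax m n).trans (left_vid _).symm
    have hR : E.right (E.vid (F.pro m)) = E.left (F.lax n p) :=
      (right_vid _).trans (F.left_lax n p).symm
    rw [hcompCell_of_vcomp _ ((G.right_lax _ _).trans (left_vid _).symm) (G.cell_compat hL) rfl
        (by rw [G.functorial.cell_vid, vcomp_vid]),
      hcompCell_of_vcomp _ ((right_vid _).trans (G.left_lax _ _).symm) (G.cell_compat hR)
        (by rw [G.functorial.cell_vid, vcomp_vid]) rfl]
    have e1 := G.lax_naturality _ _ hL (G.cell_compat hL)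
    have e2 := G.lax_naturality _ _ hR (G.cell_compat hR)
    have e3 := G.lax_associativity (F.pro m) (F.pro n) (F.pro p)
    have e4 := congrArg (G.cell) (F.lax_associativity m n p)
    simp only [G.functorial.cell_vcomp] at e4
    simp only [vcomp_assoc]
    rw [← vcomp_assoc _ (G.lax _ _) (K.vcomp _ _), ← e1, vcomp_assoc, e4]
    rw [← vcomp_assoc _ (G.lax (F.pro m) _) (G.cell _), ← e2]
    simp only [← vcomp_assoc] at e3 ⊢
    rw [e3]
  lax_left_unitality m := by
    have hL : E.right (F.unit _) = E.left (E.vid (F.pro m)) :=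
      (F.right_unit _).trans (left_vid _).symm
    rw [hcompCell_of_vcomp _ ((G.right_unit _).trans (left_vid _).symm) (G.cell_compat hL) rfl
        (by rw [G.functorial.cell_vid, vcomp_vid])]
    have e1 := G.lax_naturality _ _ hL (G.cell_compat hL)
    have e3 := G.lax_left_unitality (F.pro m)
    have e4 := congrArg (G.cell) (F.lax_left_unitality m)
    simp only [G.functorial.cell_vcomp] at e4
    simp only [vcomp_assoc]
    rw [← vcomp_assoc _ (G.lax _ _) (K.vcomp _ _), ← e1, vcomp_assoc, e4, e3]
  lax_right_unitality m := by
    have hL : E.right (E.vid (F.pro m)) = E.left (F.unit _) :=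
      (right_vid _).trans (F.left_unit _).symm
    rw [hcompCell_of_vcomp _ ((right_vid _).trans (G.left_unit _).symm) (G.cell_compat hL)
        (by rw [G.functorial.cell_vid, vcomp_vid]) rfl]
    have e1 := G.lax_naturality _ _ hL (G.cell_compat hL)
    have e3 := G.lax_right_unitality (F.pro m)
    have e4 := congrArg (G.cell) (F.lax_right_unitality m)
    simp only [G.functorial.cell_vcomp] at e4
    simp only [vcomp_assoc]
    rw [← vcomp_assoc _ (G.lax _ _) (K.vcomp _ _), ← e1, vcomp_assoc, e4, e3]

end Composition

/-! ## Cospans -/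

section Cospans

variable {A : Type u} [Category.{v} A]

/-- Cospans `a ⟶ apex ⟵ b`. -/
structure Cosp (a b : A) where
  /-- apex -/
  apex : A
  /-- left leg -/
  l : a ⟶ apex
  /-- right leg -/
  r : b ⟶ apex

/-- Morphisms of cospans, with arbitrary foot maps. -/
@[ext]
structure CospHom {a b c d : A} (p : Cosp a b) (q : Cosp c d) where
  /-- left foot map -/
  left : a ⟶ c
  /-- right foot map -/
  right : b ⟶ d
  /-- apex map -/
  hom : p.apex ⟶ q.apex
  wl : p.l ≫ hom = left ≫ q.l
  wr : p.r ≫ hom = right ≫ q.r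

/-- The identity morphism of a cospan. -/
@[reducible]
def CospHom.id {a b : A} (p : Cosp a b) : CospHom p p where
  left := 𝟙 a
  right := 𝟙 b
  hom := 𝟙 p.apex
  wl := by simp
  wr := by simp

/-- Composition of morphisms of cospans. -/
@[reducible]
def CospHom.comp {a b c d e f : A} {p : Cosp a b} {q : Cosp c d} {s : Cosp e f}
    (α : CospHom p q) (β : CospHom q s) : CospHom p s where
  left := α.left ≫ β.left
  right := α.right ≫ β.right
  hom := α.hom ≫ β.hom
  wl := by rw [← Category.assoc, α.wl, Category.assoc, β.wl, Category.assoc]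
  wr := by rw [← Category.assoc, α.wr, Category.assoc, β.wr, Category.assoc]

/-- The identity cospan. -/
@[reducible]
def Cosp.id (a : A) : Cosp a a where
  apex := a
  l := 𝟙 a
  r := 𝟙 a

/-- The external identity on an arrow. -/
@[reducible]
def CospHom.hid {a b : A} (f : a ⟶ b) : CospHom (Cosp.id a) (Cosp.id b) where
  left := f
  right := f
  hom := f
  wl := by simp
  wr := by simp

variable [HasPushouts A]

attribute [local simp] pushout.inl_desc pushout.inl_desc_assoc pushout.inr_desc pushout.inr_desc_assoc

/-- Composition of cospans by pushout. -/
@[reducible]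
noncomputable def Cosp.comp {a b c : A} (p : Cosp a b) (q : Cosp b c) : Cosp a c where
  apex := pushout p.r q.l
  l := p.l ≫ pushout.inl p.r q.l
  r := q.r ≫ pushout.inr p.r q.l

/-- External composition of morphisms of cospans. -/
@[reducible]
noncomputable def CospHom.hcomp {a b c a' b' c' : A} {p : Cosp a b} {q : Cosp b c} {p' : Cosp a' b'}
    {q' : Cosp b' c'} (α : CospHom p p') (β : CospHom q q') (h : α.right = β.left) :
    CospHom (p.comp q) (p'.comp q') where
  left := α.left
  right := β.right
  hom := pushout.desc (α.hom ≫ pushout.inl p'.r q'.l) (β.hom ≫ pushout.inr p'.r q'.l) (by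
    rw [← Category.assoc, ← Category.assoc, α.wr, β.wl, h, Category.assoc, Category.assoc,
      pushout.condition])
  wl := by
    simp only [Category.assoc, pushout.inl_desc]
    rw [← Category.assoc, α.wl, Category.assoc]
  wr := by
    simp only [Category.assoc, pushout.inr_desc]
    rw [← Category.assoc, β.wr, Category.assoc]

variable (A) in
/-- The data of the double category of cospans in `A`: objects and arrows are those of `A`,
proarrows are cospans, cells are morphisms of cospans, external composition is by pushout. -/
@[reducible]
noncomputable def cspData : DoubleData.{u, v, max u v, v} where
  Obj := A
  Pro a b := Cosp a b
  Cell p q := CospHom p q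
  left α := α.left
  right α := α.right
  vid := CospHom.id
  vcomp := CospHom.comp
  hid := Cosp.id
  hidCell := CospHom.hid
  hcomp := Cosp.comp
  hcompCell := CospHom.hcomp

/-- The associator of cospans. -/
@[reducible]
noncomputable def cspAssoc {a b c d : A} (p : Cosp a b) (q : Cosp b c) (s : Cosp c d) :
    (cspData A).GlobIso ((p.comp q).comp s) (p.comp (q.comp s)) where
  hom :=
    { left := 𝟙 a
      right := 𝟙 d
      hom := pushout.desc
        (pushout.desc (pushout.inl p.r (q.comp s).l)
          (pushout.inl q.r s.l ≫ pushout.inr p.r (q.comp s).l) (by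
            simp [pushout.condition]))
        (pushout.inr q.r s.l ≫ pushout.inr p.r (q.comp s).l) (by
          simp [pushout.condition_assoc])
      wl := by simp
      wr := by simp }
  inv :=
    { left := 𝟙 a
      right := 𝟙 d
      hom := pushout.desc
        (pushout.inl p.r q.l ≫ pushout.inl (p.comp q).r s.l)
        (pushout.desc (pushout.inr p.r q.l ≫ pushout.inl (p.comp q).r s.l)
          (pushout.inr (p.comp q).r s.l) (by
            simp [← pushout.condition]))
        (by simp [pushout.condition_assoc])
      wl := by simp
      wr := by simp }
  left_hom := rfl
  right_hom := rfl
  hom_inv := by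
    ext <;> simp
  inv_hom := by
    ext <;> simp

/-- The left unitor of cospans. -/
@[reducible]
noncomputable def cspLeftUnitor {a b : A} (p : Cosp a b) :
    (cspData A).GlobIso ((Cosp.id a).comp p) p where
  hom :=
    { left := 𝟙 a
      right := 𝟙 b
      hom := pushout.desc p.l (𝟙 p.apex) (by simp)
      wl := by simp
      wr := by simp }
  inv :=
    { left := 𝟙 a
      right := 𝟙 b
      hom := pushout.inr (𝟙 a) p.l
      wl := by simp [← pushout.condition]
      wr := by simp }
  left_hom := rfl
  right_hom := rfl
  hom_inv := by
    ext <;> simp [← pushout.condition]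
  inv_hom := by ext <;> simp

/-- The right unitor of cospans. -/
@[reducible]
noncomputable def cspRightUnitor {a b : A} (p : Cosp a b) :
    (cspData A).GlobIso (p.comp (Cosp.id b)) p where
  hom :=
    { left := 𝟙 a
      right := 𝟙 b
      hom := pushout.desc (𝟙 p.apex) p.r (by simp)
      wl := by simp
      wr := by simp }
  inv :=
    { left := 𝟙 a
      right := 𝟙 b
      hom := pushout.inl p.r (𝟙 b)
      wl := by simp
      wr := by simp [pushout.condition] }
  left_hom := rfl
  right_hom := rfl
  hom_inv := by
    ext <;> simp [pushout.condition]
  inv_hom := by ext <;> simp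

variable (A) in
/-- The double category of cospans. -/
noncomputable instance cspDoubleCategory : DoubleCategory (cspData A) where
  left_vid _ := rfl
  right_vid _ := rfl
  left_vcomp _ _ := rfl
  right_vcomp _ _ := rfl
  vid_vcomp α := by ext <;> simp
  vcomp_vid α := by ext <;> simp
  vcomp_assoc α β γ := by ext <;> simp
  left_hidCell _ := rfl
  right_hidCell _ := rfl
  hidCell_id _ := rfl
  hidCell_comp _ _ := rfl
  left_hcompCell _ _ _ := rfl
  right_hcompCell _ _ _ := rfl
  hcompCell_vid p q := by
    ext <;> simp
  hcompCell_vcomp α β α' β' h h' := by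
    ext <;> simp
  associator := cspAssoc
  leftUnitor := cspLeftUnitor
  rightUnitor := cspRightUnitor
  associator_naturality α β γ h k := by
    ext <;> simp
  leftUnitor_naturality α := by
    ext <;> simp [α.wl]
  rightUnitor_naturality α := by
    ext <;> simp [α.wr]
  pentagon p q s t := by
    ext <;> simp
  triangle p q := by
    ext <;> simp [pushout.condition]

end Cospans

/-! ## Spans -/

section Spans

/-- A choice of pullbacks in a category. -/
class ChosenPullbacks (C : Type u) [Category.{v} C] where
  /-- the chosen pullback -/
  pb : ∀ {X Y S : C} (f : X ⟶ S) (g : Y ⟶ S), ChosenPullback f g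

variable {C : Type u} [Category.{v} C]

/-- The morphism into a chosen pullback induced by a commutative square. -/
def pbLift {X Y S T : C} {f : X ⟶ S} {g : Y ⟶ S} (P : ChosenPullback f g) (h : T ⟶ X) (k : T ⟶ Y)
    (w : h ≫ f = k ≫ g) : T ⟶ P.pullback :=
  PullbackCone.IsLimit.lift P.isLimit h k w

theorem pbLift_fst {X Y S T : C} {f : X ⟶ S} {g : Y ⟶ S} (P : ChosenPullback f g) (h : T ⟶ X)
    (k : T ⟶ Y) (w : h ≫ f = k ≫ g) : pbLift P h k w ≫ P.p₁ = h :=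
  PullbackCone.IsLimit.lift_fst P.isLimit h k w

theorem pbLift_snd {X Y S T : C} {f : X ⟶ S} {g : Y ⟶ S} (P : ChosenPullback f g) (h : T ⟶ X)
    (k : T ⟶ Y) (w : h ≫ f = k ≫ g) : pbLift P h k w ≫ P.p₂ = k :=
  PullbackCone.IsLimit.lift_snd P.isLimit h k w

theorem pbLift_fst_assoc {X Y S T : C} {f : X ⟶ S} {g : Y ⟶ S} (P : ChosenPullback f g) (h : T ⟶ X)
    (k : T ⟶ Y) (w : h ≫ f = k ≫ g) {Z : C} (l : X ⟶ Z) : pbLift P h k w ≫ P.p₁ ≫ l = h ≫ l := by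
  rw [← Category.assoc, pbLift_fst]

theorem pbLift_snd_assoc {X Y S T : C} {f : X ⟶ S} {g : Y ⟶ S} (P : ChosenPullback f g) (h : T ⟶ X)
    (k : T ⟶ Y) (w : h ≫ f = k ≫ g) {Z : C} (l : Y ⟶ Z) : pbLift P h k w ≫ P.p₂ ≫ l = k ≫ l := by
  rw [← Category.assoc, pbLift_snd]

theorem pbLift_p {X Y S T : C} {f : X ⟶ S} {g : Y ⟶ S} (P : ChosenPullback f g) (h : T ⟶ X)
    (k : T ⟶ Y) (w : h ≫ f = k ≫ g) : pbLift P h k w ≫ P.p = h ≫ f := by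
  rw [← P.hp₁, pbLift_fst_assoc]

attribute [local simp] pbLift_fst pbLift_snd pbLift_fst_assoc pbLift_snd_assoc pbLift_p

/-- Spans `a ⟵ apex ⟶ b`. -/
structure Spn (a b : C) where
  /-- apex -/
  apex : C
  /-- left leg -/
  l : apex ⟶ a
  /-- right leg -/
  r : apex ⟶ b

/-- Morphisms of spans, with arbitrary foot maps. -/
@[ext]
structure SpnHom {a b c d : C} (p : Spn a b) (q : Spn c d) where
  /-- left foot map -/
  left : a ⟶ c
  /-- right foot map -/
  right : b ⟶ d
  /-- apex map -/
  hom : p.apex ⟶ q.apex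
  wl : hom ≫ q.l = p.l ≫ left
  wr : hom ≫ q.r = p.r ≫ right

/-- The identity morphism of a span. -/
@[reducible]
def SpnHom.id {a b : C} (p : Spn a b) : SpnHom p p where
  left := 𝟙 a
  right := 𝟙 b
  hom := 𝟙 p.apex
  wl := by simp
  wr := by simp

/-- Composition of morphisms of spans. -/
@[reducible]
def SpnHom.comp {a b c d e f : C} {p : Spn a b} {q : Spn c d} {s : Spn e f}
    (α : SpnHom p q) (β : SpnHom q s) : SpnHom p s where
  left := α.left ≫ β.left
  right := α.right ≫ β.right
  hom := α.hom ≫ β.hom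
  wl := by rw [Category.assoc, β.wl, ← Category.assoc, α.wl, Category.assoc]
  wr := by rw [Category.assoc, β.wr, ← Category.assoc, α.wr, Category.assoc]

/-- The identity span. -/
@[reducible]
def Spn.id (a : C) : Spn a a where
  apex := a
  l := 𝟙 a
  r := 𝟙 a

/-- The external identity on an arrow. -/
@[reducible]
def SpnHom.hid {a b : C} (f : a ⟶ b) : SpnHom (Spn.id a) (Spn.id b) where
  left := f
  right := f
  hom := f
  wl := by simp
  wr := by simp

variable [ChosenPullbacks C]

open ChosenPullbacks

/-- Composition of spans by the chosen pullback. -/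
@[reducible]
def Spn.comp {a b c : C} (p : Spn a b) (q : Spn b c) : Spn a c where
  apex := (pb p.r q.l).pullback
  l := (pb p.r q.l).p₁ ≫ p.l
  r := (pb p.r q.l).p₂ ≫ q.r

/-- External composition of morphisms of spans. -/
@[reducible]
def SpnHom.hcomp {a b c a' b' c' : C} {p : Spn a b} {q : Spn b c} {p' : Spn a' b'}
    {q' : Spn b' c'} (α : SpnHom p p') (β : SpnHom q q') (h : α.right = β.left) :
    SpnHom (p.comp q) (p'.comp q') where
  left := α.left
  right := β.right
  hom := pbLift (pb p'.r q'.l) ((pb p.r q.l).p₁ ≫ α.hom) ((pb p.r q.l).p₂ ≫ β.hom) (by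
    rw [Category.assoc, Category.assoc, α.wr, β.wl, h, ← Category.assoc, ← Category.assoc,
      ChosenPullback.condition])
  wl := by simp [α.wl]
  wr := by simp [β.wr]

variable (C) in
/-- The data of the double category of spans in `C`: objects and arrows are those of `C`,
proarrows are spans, cells are morphisms of spans, external composition is by pullback. -/
@[reducible]
def spanData : DoubleData.{u, v, max u v, v} where
  Obj := C
  Pro a b := Spn a b
  Cell p q := SpnHom p q
  left α := α.left
  right α := α.right
  vid := SpnHom.id
  vcomp := SpnHom.comp
  hid := Spn.id
  hidCell := SpnHom.hid
  hcomp := Spn.comp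
  hcompCell := SpnHom.hcomp

/-- The associator of spans. -/
@[reducible]
def spanAssoc {a b c d : C} (p : Spn a b) (q : Spn b c) (s : Spn c d) :
    (spanData C).GlobIso ((p.comp q).comp s) (p.comp (q.comp s)) where
  hom :=
    { left := 𝟙 a
      right := 𝟙 d
      hom := pbLift (pb p.r (q.comp s).l) ((pb (p.comp q).r s.l).p₁ ≫ (pb p.r q.l).p₁)
        (pbLift (pb q.r s.l) ((pb (p.comp q).r s.l).p₁ ≫ (pb p.r q.l).p₂) (pb (p.comp q).r s.l).p₂
          (by simp))
        (by simp)
      wl := by simp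
      wr := by simp }
  inv :=
    { left := 𝟙 a
      right := 𝟙 d
      hom := pbLift (pb (p.comp q).r s.l)
        (pbLift (pb p.r q.l) (pb p.r (q.comp s).l).p₁ ((pb p.r (q.comp s).l).p₂ ≫ (pb q.r s.l).p₁)
          (by simp))
        ((pb p.r (q.comp s).l).p₂ ≫ (pb q.r s.l).p₂)
        (by simp)
      wl := by simp
      wr := by simp }
  left_hom := rfl
  right_hom := rfl
  hom_inv := by ext <;> simp
  inv_hom := by ext <;> simp

/-- The left unitor of spans. -/
@[reducible]
def spanLeftUnitor {a b : C} (p : Spn a b) :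
    (spanData C).GlobIso ((Spn.id a).comp p) p where
  hom :=
    { left := 𝟙 a
      right := 𝟙 b
      hom := (pb (𝟙 a) p.l).p₂
      wl := by simpa using (pb (𝟙 a) p.l).condition.symm
      wr := by simp }
  inv :=
    { left := 𝟙 a
      right := 𝟙 b
      hom := pbLift (pb (𝟙 a) p.l) p.l (𝟙 p.apex) (by simp)
      wl := by simp
      wr := by simp }
  left_hom := rfl
  right_hom := rfl
  hom_inv := by
    ext <;> simp
    rw [← ChosenPullback.hp₁, Category.comp_id]
  inv_hom := by ext <;> simp

/-- The right unitor of spans. -/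
@[reducible]
def spanRightUnitor {a b : C} (p : Spn a b) :
    (spanData C).GlobIso (p.comp (Spn.id b)) p where
  hom :=
    { left := 𝟙 a
      right := 𝟙 b
      hom := (pb p.r (𝟙 b)).p₁
      wl := by simp
      wr := by simpa using (pb p.r (𝟙 b)).condition }
  inv :=
    { left := 𝟙 a
      right := 𝟙 b
      hom := pbLift (pb p.r (𝟙 b)) (𝟙 p.apex) p.r (by simp)
      wl := by simp
      wr := by simp }
  left_hom := rfl
  right_hom := rfl
  hom_inv := by
    ext <;> simp
    rw [← ChosenPullback.hp₂, Category.comp_id]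
  inv_hom := by ext <;> simp

variable (C) in
/-- The double category of spans. -/
instance spanDoubleCategory : DoubleCategory (spanData C) where
  left_vid _ := rfl
  right_vid _ := rfl
  left_vcomp _ _ := rfl
  right_vcomp _ _ := rfl
  vid_vcomp α := by ext <;> simp
  vcomp_vid α := by ext <;> simp
  vcomp_assoc α β γ := by ext <;> simp
  left_hidCell _ := rfl
  right_hidCell _ := rfl
  hidCell_id _ := rfl
  hidCell_comp _ _ := rfl
  left_hcompCell _ _ _ := rfl
  right_hcompCell _ _ _ := rfl
  hcompCell_vid p q := by ext <;> simp
  hcompCell_vcomp α β α' β' h h' := by ext <;> simp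
  associator := spanAssoc
  leftUnitor := spanLeftUnitor
  rightUnitor := spanRightUnitor
  associator_naturality α β γ h k := by ext <;> simp
  leftUnitor_naturality α := by ext <;> simp
  rightUnitor_naturality α := by ext <;> simp
  pentagon p q s t := by ext <;> simp
  triangle p q := by ext <;> simp

end Spans

/-! ## Monoidal categories as double categories -/

section Monoidal

variable (C : Type u) [Category.{v} C] [MonoidalCategory C]

/-- The data of the double category of a monoidal category `C`: the category of objects and arrows
is trivial, proarrows and cells are the objects and morphisms of `C`, external composition and
identity are the tensor product and unit. -/
@[reducible]
def monData : DoubleData.{0, 0, u, v} where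
  Obj := Discrete Unit
  Pro _ _ := C
  Cell X Y := X ⟶ Y
  left _ := eqToHom (Subsingleton.elim _ _)
  right _ := eqToHom (Subsingleton.elim _ _)
  vid := fun X => 𝟙 X
  vcomp f g := f ≫ g
  hid _ := 𝟙_ C
  hidCell _ := 𝟙 (𝟙_ C)
  hcomp X Y := X ⊗ Y
  hcompCell f g _ := f ⊗ₘ g

/-- Isomorphisms in `C` as globular isomorphisms. -/
@[reducible]
def monGlobIso {a b : Discrete Unit} {X Y : C} (e : X ≅ Y) :
    (monData C).GlobIso (a := a) (b := b) X Y where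
  hom := e.hom
  inv := e.inv
  left_hom := Subsingleton.elim _ _
  right_hom := Subsingleton.elim _ _
  hom_inv := e.hom_inv_id
  inv_hom := e.inv_hom_id

/-- The double category of a monoidal category. -/
instance monDoubleCategory : DoubleCategory (monData C) where
  left_vid _ := Subsingleton.elim _ _
  right_vid _ := Subsingleton.elim _ _
  left_vcomp _ _ := Subsingleton.elim _ _
  right_vcomp _ _ := Subsingleton.elim _ _
  vid_vcomp _ := Category.id_comp _
  vcomp_vid _ := Category.comp_id _
  vcomp_assoc _ _ _ := Category.assoc _ _ _
  left_hidCell _ := Subsingleton.elim _ _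
  right_hidCell _ := Subsingleton.elim _ _
  hidCell_id _ := rfl
  hidCell_comp _ _ := by simp
  left_hcompCell _ _ _ := rfl
  right_hcompCell _ _ _ := rfl
  hcompCell_vid _ _ := by simp
  hcompCell_vcomp _ _ _ _ _ _ := by simp
  associator X Y Z := monGlobIso C (α_ X Y Z)
  leftUnitor X := monGlobIso C (λ_ X)
  rightUnitor X := monGlobIso C (ρ_ X)
  associator_naturality _ _ _ _ _ := by simp
  leftUnitor_naturality _ := by simp
  rightUnitor_naturality _ := by simp
  pentagon _ _ _ _ := by simp
  triangle _ _ := by simp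

end Monoidal

section MonoidalFunctors

variable {C : Type u} [Category.{v} C] [MonoidalCategory C]
  {E : Type u₁} [Category.{v₁} E] [MonoidalCategory E]

/-- The lax double functor induced by a lax monoidal functor. -/
@[reducible]
def monMap (F : C ⥤ E) [F.LaxMonoidal] : LaxDoubleFunctor (monData C) (monData E) where
  obj a := a
  map f := f
  pro X := F.obj X
  cell f := F.map f
  functorial :=
    { map_id := fun _ => rfl
      map_comp := fun _ _ => rfl
      left_cell := fun _ => rfl
      right_cell := fun _ => rfl
      cell_vid := fun _ => F.map_id _
      cell_vcomp := fun _ _ => F.map_comp _ _ }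
  lax X Y := Functor.LaxMonoidal.μ F X Y
  left_lax _ _ := Subsingleton.elim _ _
  right_lax _ _ := Subsingleton.elim _ _
  unit _ := Functor.LaxMonoidal.ε F
  left_unit _ := Subsingleton.elim _ _
  right_unit _ := Subsingleton.elim _ _
  lax_naturality f g _ _ := (Functor.LaxMonoidal.μ_natural F f g).symm
  unit_naturality _ := by simp
  lax_associativity X Y Z := by simp [DoubleCategory.associator]
  lax_left_unitality X := by simp [DoubleCategory.leftUnitor]
  lax_right_unitality X := by simp [DoubleCategory.rightUnitor]

end MonoidalFunctors

/-! ## The apex double functors -/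

section Apex

attribute [local simp] coprod.inl_desc coprod.inl_desc_assoc coprod.inr_desc coprod.inr_desc_assoc

theorem apexCsp_assoc {A : Type u} [Category.{v} A] [HasFiniteColimits A] {a b c d : A}
    (p : Cosp a b) (q : Cosp b c) (s : Cosp c d) :
    coprod.map (coprod.desc (pushout.inl p.r q.l) (pushout.inr p.r q.l)) (𝟙 s.apex) ≫
      coprod.desc (pushout.inl (p.comp q).r s.l) (pushout.inr (p.comp q).r s.l) ≫
        (cspAssoc p q s).hom.hom =
    coprod.desc (coprod.desc coprod.inl (coprod.inl ≫ coprod.inr)) (coprod.inr ≫ coprod.inr) ≫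
      coprod.map (𝟙 p.apex) (coprod.desc (pushout.inl q.r s.l) (pushout.inr q.r s.l)) ≫
        coprod.desc (pushout.inl p.r (q.comp s).l) (pushout.inr p.r (q.comp s).l) := by
  apply coprod.hom_ext
  · apply coprod.hom_ext <;> simp [pushout.inl_desc, pushout.inr_desc]
  · simp [pushout.inr_desc]

theorem apexCsp_left {A : Type u} [Category.{v} A] [HasFiniteColimits A] {a b : A} (p : Cosp a b) :
    coprod.map (initial.to a) (𝟙 p.apex) ≫
      coprod.desc (pushout.inl (Cosp.id a).r p.l) (pushout.inr (Cosp.id a).r p.l) ≫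
        (cspLeftUnitor p).hom.hom = coprod.desc (initial.to p.apex) (𝟙 p.apex) := by
  apply coprod.hom_ext <;> simp [pushout.inl_desc, pushout.inr_desc]

theorem apexCsp_right {A : Type u} [Category.{v} A] [HasFiniteColimits A] {a b : A} (p : Cosp a b) :
    coprod.map (𝟙 p.apex) (initial.to b) ≫
      coprod.desc (pushout.inl p.r (Cosp.id b).l) (pushout.inr p.r (Cosp.id b).l) ≫
        (cspRightUnitor p).hom.hom = coprod.desc (𝟙 p.apex) (initial.to p.apex) := by
  apply coprod.hom_ext <;> simp [pushout.inl_desc, pushout.inr_desc]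

/-- The lax double functor from cospans in `A` to `(A, +)` that sends a cospan to its apex. Its
laxators are the canonical maps from the coproduct to the pushout of the apexes, its unitors are the
unique maps out of the initial object. -/
@[reducible]
noncomputable def apexCsp (A : Type u) [Category.{v} A] [HasFiniteColimits A] :
    letI := monoidalOfHasFiniteCoproducts A
    LaxDoubleFunctor (cspData A) (monData A) :=
  letI := monoidalOfHasFiniteCoproducts A
  { obj := fun _ => ⟨()⟩
    map := fun _ => 𝟙 _
    pro := fun p => p.apex
    cell := fun α => α.hom
    functorial :=
      { map_id := fun _ => rfl
        map_comp := fun _ _ => Subsingleton.elim _ _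
        left_cell := fun _ => Subsingleton.elim _ _
        right_cell := fun _ => Subsingleton.elim _ _
        cell_vid := fun _ => rfl
        cell_vcomp := fun _ _ => rfl }
    lax := fun p q => coprod.desc (pushout.inl p.r q.l) (pushout.inr p.r q.l)
    left_lax := fun _ _ => Subsingleton.elim _ _
    right_lax := fun _ _ => Subsingleton.elim _ _
    unit := fun a => initial.to a
    left_unit := fun _ => Subsingleton.elim _ _
    right_unit := fun _ => Subsingleton.elim _ _
    lax_naturality := fun α β h h' => by
      apply coprod.hom_ext <;> simp [pushout.inl_desc, pushout.inr_desc]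
    unit_naturality := fun f => by
      apply initial.hom_ext
    lax_associativity := fun p q s => apexCsp_assoc p q s
    lax_left_unitality := fun p => apexCsp_left p
    lax_right_unitality := fun p => apexCsp_right p }

/-- For a category `C` with finite products and pullbacks, the double functor from `(C, ×)` to
spans in `C` that sends an object `X` to the span `1 ⟵ X ⟶ 1`. -/
@[reducible]
def apexSpan (C : Type u) [Category.{v} C] [CartesianMonoidalCategory C] [ChosenPullbacks C] :
    LaxDoubleFunctor (monData C) (spanData C) where
  obj _ := 𝟙_ C
  map _ := 𝟙 (𝟙_ C)
  pro X := ⟨X, CartesianMonoidalCategory.toUnit X, CartesianMonoidalCategory.toUnit X⟩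
  cell f := ⟨𝟙 _, 𝟙 _, f, by simp, by simp⟩
  functorial :=
    { map_id := fun _ => rfl
      map_comp := fun _ _ => by simp
      left_cell := fun _ => rfl
      right_cell := fun _ => rfl
      cell_vid := fun _ => rfl
      cell_vcomp := fun _ _ => by ext <;> simp }
  lax X Y := ⟨𝟙 _, 𝟙 _, CartesianMonoidalCategory.lift
    (ChosenPullbacks.pb (CartesianMonoidalCategory.toUnit X)
      (CartesianMonoidalCategory.toUnit Y)).p₁
    (ChosenPullbacks.pb (CartesianMonoidalCategory.toUnit X)
      (CartesianMonoidalCategory.toUnit Y)).p₂, by simp, by simp⟩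
  left_lax _ _ := rfl
  right_lax _ _ := rfl
  unit _ := ⟨𝟙 _, 𝟙 _, 𝟙 _, by simp, by simp⟩
  left_unit _ := rfl
  right_unit _ := rfl
  lax_naturality f g _ _ := by
    ext <;> simp [pbLift_fst, pbLift_snd]
  unit_naturality _ := by ext <;> simp
  lax_associativity X Y Z := by
    ext <;> simp [DoubleCategory.associator, pbLift_fst, pbLift_snd, pbLift_fst_assoc, pbLift_snd_assoc]
  lax_left_unitality X := by
    ext <;> simp [DoubleCategory.leftUnitor, pbLift_fst, pbLift_snd, pbLift_fst_assoc, pbLift_snd_assoc]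
  lax_right_unitality X := by
    ext <;> simp [DoubleCategory.rightUnitor, pbLift_fst, pbLift_snd, pbLift_fst_assoc, pbLift_snd_assoc]

end Apex

/-! ## Strict pullbacks of categories -/

section CatPullback

/-- Objects of the strict pullback of two functors with common codomain. -/
@[ext]
structure CatPB {C : Type u} [Category.{v} C] {C' : Type u} [Category.{v} C'] {S : Type u}
    [Category.{v} S] (F : C ⥤ S) (G : C' ⥤ S) where
  /-- first component -/
  fst : C
  /-- second component -/
  snd : C'
  w : F.obj fst = G.obj snd

variable {C : Type u} [Category.{v} C] {C' : Type u} [Category.{v} C'] {S : Type u}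
    [Category.{v} S] {F : C ⥤ S} {G : C' ⥤ S}

/-- Morphisms of the strict pullback of two functors: pairs of morphisms with equal images. -/
@[ext]
structure CatPB.Hom (X Y : CatPB F G) where
  /-- first component -/
  fst : X.fst ⟶ Y.fst
  /-- second component -/
  snd : X.snd ⟶ Y.snd
  w : F.map fst ≍ G.map snd

theorem heq_comp_of_heq {X Y Z X' Y' Z' : S} {f : X ⟶ Y} {g : Y ⟶ Z} {f' : X' ⟶ Y'} {g' : Y' ⟶ Z'}
    (hX : X = X') (hY : Y = Y') (hZ : Z = Z') (hf : f ≍ f') (hg : g ≍ g') : f ≫ g ≍ f' ≫ g' := by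
  subst hX hY hZ
  obtain rfl := eq_of_heq hf
  obtain rfl := eq_of_heq hg
  rfl

instance : Category.{v} (CatPB F G) where
  Hom X Y := CatPB.Hom X Y
  id X := ⟨𝟙 _, 𝟙 _, by rw [F.map_id, G.map_id, X.w]⟩
  comp {X Y Z} f g := ⟨f.fst ≫ g.fst, f.snd ≫ g.snd, by
    rw [F.map_comp, G.map_comp]; exact heq_comp_of_heq X.w Y.w Z.w f.w g.w⟩
  id_comp f := by apply CatPB.Hom.ext <;> simp
  comp_id f := by apply CatPB.Hom.ext <;> simp
  assoc f g h := by apply CatPB.Hom.ext <;> simp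

theorem CatPB.hom_heq {X Y X' Y' : CatPB F G} {f : X ⟶ Y} {g : X' ⟶ Y'} (hX : X = X') (hY : Y = Y')
    (h₁ : CatPB.Hom.fst f ≍ CatPB.Hom.fst g) (h₂ : CatPB.Hom.snd f ≍ CatPB.Hom.snd g) : f ≍ g := by
  subst hX hY
  exact heq_of_eq (CatPB.Hom.ext (eq_of_heq h₁) (eq_of_heq h₂))

/-- The chosen pullbacks in the category of categories are the strict ones. -/
instance : ChosenPullbacks Cat.{v, u} where
  pb {X Y S} f g :=
    { pullback := Cat.of (CatPB f.toFunctor g.toFunctor)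
      p₁ := Functor.toCatHom
        { obj := fun P => CatPB.fst P, map := fun a => CatPB.Hom.fst a,
          map_id := fun _ => rfl, map_comp := fun _ _ => rfl }
      p₂ := Functor.toCatHom
        { obj := fun P => CatPB.snd P, map := fun a => CatPB.Hom.snd a,
          map_id := fun _ => rfl, map_comp := fun _ _ => rfl }
      condition := Cat.Hom.ext (Functor.hext (fun P => CatPB.w P) (fun _ _ a => CatPB.Hom.w a))
      isLimit := PullbackCone.IsLimit.mk _
        (fun s => Functor.toCatHom
          { obj := fun t => ⟨s.fst.toFunctor.obj t, s.snd.toFunctor.obj t,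
              congrArg (fun h => h.toFunctor.obj t) s.condition⟩
            map := fun a => ⟨s.fst.toFunctor.map a, s.snd.toFunctor.map a, by
              exact Functor.hcongr_hom (congrArg (fun h => h.toFunctor) s.condition) a⟩
            map_id := fun t => CatPB.Hom.ext (s.fst.toFunctor.map_id t) (s.snd.toFunctor.map_id t)
            map_comp := fun a b =>
              CatPB.Hom.ext (s.fst.toFunctor.map_comp a b) (s.snd.toFunctor.map_comp a b) })
        (fun _ => rfl) (fun _ => rfl)
        (fun s m h₁ h₂ => Cat.Hom.ext (Functor.hext
          (fun t => CatPB.ext (congrArg (fun h => h.toFunctor.obj t) h₁)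
            (congrArg (fun h => h.toFunctor.obj t) h₂))
          (fun t t' a => CatPB.hom_heq
            (CatPB.ext (congrArg (fun h => h.toFunctor.obj t) h₁)
              (congrArg (fun h => h.toFunctor.obj t) h₂))
            (CatPB.ext (congrArg (fun h => h.toFunctor.obj t') h₁)
              (congrArg (fun h => h.toFunctor.obj t') h₂))
            (Functor.hcongr_hom (congrArg (fun h => h.toFunctor) h₁) a)
            (Functor.hcongr_hom (congrArg (fun h => h.toFunctor) h₂) a)))) }

end CatPullback

/-! ## The double Grothendieck construction -/

section Grothendieck

theorem heq_map_of_heq {C : Type u} [Category.{v} C] {C' : Type u₁} [Category.{v₁} C'] (G : C ⥤ C')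
    {X Y X' Y' : C} {f : X ⟶ Y} {g : X' ⟶ Y'} (hX : X = X') (hY : Y = Y') (h : f ≍ g) :
    G.map f ≍ G.map g := by
  subst hX hY
  obtain rfl := eq_of_heq h
  rfl

theorem heq_map_of_cat_eq {C C' : Cat.{v, u}} {G H : C ⟶ C'} (h : G = H) {X Y : C} (f : X ⟶ Y) :
    G.toFunctor.map f ≍ H.toFunctor.map f := by
  subst h; rfl

theorem heq_eqToHom {C : Type u} [Category.{v} C] {X Y X' Y' : C} (p : X = Y) (q : X' = Y')
    (h : X = X') : eqToHom p ≍ eqToHom q := by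
  subst h p q; rfl

theorem cat_obj_of_eq {C C' : Cat.{v, u}} {G H : C ⟶ C'} (h : G = H) (X : C) :
    G.toFunctor.obj X = H.toFunctor.obj X := by rw [h]

variable {D : DoubleData.{u₁, v₁, u₂, v₂}} [DoubleCategory D]
  (F : LaxDoubleFunctor D (spanData Cat.{v, u}))

/-- The functor from objects and arrows to categories underlying a lax double functor into spans of
categories. -/
@[reducible]
def dgBase : D.Obj ⥤ Cat.{v, u} where
  obj := F.obj
  map := F.map
  map_id := F.functorial.map_id
  map_comp := F.functorial.map_comp

/-- Proarrows `(a, x) ⇸ (b, y)` of the double Grothendieck construction: a proarrow `m : a ⇸ b` and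
an object of the apex of `F m` that lies over `x` and `y`. -/
@[ext]
structure DGPro (X Y : Grothendieck (dgBase F)) where
  /-- the underlying proarrow -/
  base : D.Pro X.base Y.base
  /-- the object of the apex -/
  fiber : (F.pro base).apex
  src : (F.pro base).l.toFunctor.obj fiber = X.fiber
  tgt : (F.pro base).r.toFunctor.obj fiber = Y.fiber

variable {F}

/-- Cells `(m, s) ⟶ (n, t)` of the double Grothendieck construction: a cell `α : m ⟶ n` and a
morphism `apex (F α) (s) ⟶ t` in the apex of `F n`. -/
structure DGCell {X Y Z W : Grothendieck (dgBase F)} (P : DGPro F X Y) (Q : DGPro F Z W) where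
  /-- the underlying cell -/
  base : D.Cell P.base Q.base
  /-- the morphism of the apex -/
  fiber : (F.cell base).hom.toFunctor.obj P.fiber ⟶ Q.fiber

variable {X Y Z W X' Y' Z' W' X'' Y'' Z'' : Grothendieck (dgBase F)}

theorem DGCell.ext_heq {P : DGPro F X Y} {Q : DGPro F Z W} {α β : DGCell P Q}
    (h : α.base = β.base) (h' : α.fiber ≍ β.fiber) : α = β := by
  obtain ⟨a, x⟩ := α
  obtain ⟨b, y⟩ := β
  obtain rfl : a = b := h
  obtain rfl := eq_of_heq h'
  rfl

theorem dg_hom_ext {f g : X ⟶ Y} (h : f.base = g.base) (h' : f.fiber ≍ g.fiber) : f = g := by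
  obtain ⟨a, x⟩ := f
  obtain ⟨b, y⟩ := g
  obtain rfl : a = b := h
  obtain rfl := eq_of_heq h'
  rfl

theorem dg_cell_l {a b c d : D.Obj} {m : D.Pro a b} {n : D.Pro c d} (α : D.Cell m n) :
    (F.cell α).hom ≫ (F.pro n).l = (F.pro m).l ≫ F.map (D.left α) := by
  rw [(F.cell α).wl, ← F.functorial.left_cell]

theorem dg_cell_r {a b c d : D.Obj} {m : D.Pro a b} {n : D.Pro c d} (α : D.Cell m n) :
    (F.cell α).hom ≫ (F.pro n).r = (F.pro m).r ≫ F.map (D.right α) := by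
  rw [(F.cell α).wr, ← F.functorial.right_cell]

theorem dg_cell_vid {a b : D.Obj} (m : D.Pro a b) : (F.cell (D.vid m)).hom = 𝟙 (F.pro m).apex := by
  rw [F.functorial.cell_vid]

theorem dg_cell_vcomp {a b c d e f : D.Obj} {m : D.Pro a b} {n : D.Pro c d} {p : D.Pro e f}
    (α : D.Cell m n) (β : D.Cell n p) :
    (F.cell (D.vcomp α β)).hom = (F.cell α).hom ≫ (F.cell β).hom := by
  rw [F.functorial.cell_vcomp]

theorem dg_left_obj {P : DGPro F X Y} {Q : DGPro F Z W} (α : D.Cell P.base Q.base) :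
    (F.pro Q.base).l.toFunctor.obj ((F.cell α).hom.toFunctor.obj P.fiber) =
      (F.map (D.left α)).toFunctor.obj X.fiber := by
  rw [← P.src]
  exact cat_obj_of_eq (dg_cell_l α) P.fiber

theorem dg_right_obj {P : DGPro F X Y} {Q : DGPro F Z W} (α : D.Cell P.base Q.base) :
    (F.pro Q.base).r.toFunctor.obj ((F.cell α).hom.toFunctor.obj P.fiber) =
      (F.map (D.right α)).toFunctor.obj Y.fiber := by
  rw [← P.tgt]
  exact cat_obj_of_eq (dg_cell_r α) P.fiber

/-- The left boundary of a cell. -/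
@[reducible]
def DGCell.left {P : DGPro F X Y} {Q : DGPro F Z W} (α : DGCell P Q) : X ⟶ Z where
  base := D.left α.base
  fiber := eqToHom (dg_left_obj α.base).symm ≫ (F.pro Q.base).l.toFunctor.map α.fiber ≫
    eqToHom Q.src

/-- The right boundary of a cell. -/
@[reducible]
def DGCell.right {P : DGPro F X Y} {Q : DGPro F Z W} (α : DGCell P Q) : Y ⟶ W where
  base := D.right α.base
  fiber := eqToHom (dg_right_obj α.base).symm ≫ (F.pro Q.base).r.toFunctor.map α.fiber ≫
    eqToHom Q.tgt

/-- The internal identity cell. -/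
@[reducible]
def DGCell.vid (P : DGPro F X Y) : DGCell P P where
  base := D.vid P.base
  fiber := eqToHom (cat_obj_of_eq (dg_cell_vid P.base) P.fiber)

/-- Internal composition of cells. -/
@[reducible]
def DGCell.vcomp {P : DGPro F X Y} {Q : DGPro F Z W} {R : DGPro F X' Y'} (α : DGCell P Q)
    (β : DGCell Q R) : DGCell P R where
  base := D.vcomp α.base β.base
  fiber := eqToHom (cat_obj_of_eq (dg_cell_vcomp α.base β.base) P.fiber) ≫
    (F.cell β.base).hom.toFunctor.map α.fiber ≫ β.fiber

theorem dg_unit_l (a : D.Obj) : (F.unit a).hom ≫ (F.pro (D.hid a)).l = 𝟙 (F.obj a) := by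
  rw [(F.unit a).wl, show (F.unit a).left = 𝟙 (F.obj a) from F.left_unit a, Category.comp_id]

theorem dg_unit_r (a : D.Obj) : (F.unit a).hom ≫ (F.pro (D.hid a)).r = 𝟙 (F.obj a) := by
  rw [(F.unit a).wr, show (F.unit a).right = 𝟙 (F.obj a) from F.right_unit a, Category.comp_id]

theorem dg_unit_naturality {a b : D.Obj} (f : a ⟶ b) :
    (F.unit a).hom ≫ (F.cell (D.hidCell f)).hom = F.map f ≫ (F.unit b).hom :=
  congrArg SpnHom.hom (F.unit_naturality f)

/-- The identity proarrow. -/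
@[reducible]
def DGPro.hid (X : Grothendieck (dgBase F)) : DGPro F X X where
  base := D.hid X.base
  fiber := (F.unit X.base).hom.toFunctor.obj X.fiber
  src := cat_obj_of_eq (dg_unit_l X.base) X.fiber
  tgt := cat_obj_of_eq (dg_unit_r X.base) X.fiber

/-- The external identity cell on an arrow. -/
@[reducible]
def DGCell.hid (f : X ⟶ Y) : DGCell (DGPro.hid X) (DGPro.hid Y) where
  base := D.hidCell f.base
  fiber := eqToHom (cat_obj_of_eq (dg_unit_naturality f.base) X.fiber) ≫
    (F.unit Y.base).hom.toFunctor.map f.fiber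

theorem dg_lax_l {a b c : D.Obj} (m : D.Pro a b) (n : D.Pro b c) :
    (F.lax m n).hom ≫ (F.pro (D.hcomp m n)).l =
      ((spanData Cat.{v, u}).hcomp (F.pro m) (F.pro n)).l := by
  rw [(F.lax m n).wl, show (F.lax m n).left = 𝟙 (F.obj a) from F.left_lax m n, Category.comp_id]

theorem dg_lax_r {a b c : D.Obj} (m : D.Pro a b) (n : D.Pro b c) :
    (F.lax m n).hom ≫ (F.pro (D.hcomp m n)).r =
      ((spanData Cat.{v, u}).hcomp (F.pro m) (F.pro n)).r := by
  rw [(F.lax m n).wr, show (F.lax m n).right = 𝟙 (F.obj c) from F.right_lax m n, Category.comp_id]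

/-- The pair of composable decorations `(s, t)` as an object of the pullback. -/
@[reducible]
def DGPro.pair (P : DGPro F X Y) (Q : DGPro F Y Z) :
    CatPB (F.pro P.base).r.toFunctor (F.pro Q.base).l.toFunctor :=
  ⟨P.fiber, Q.fiber, P.tgt.trans Q.src.symm⟩

/-- External composition of proarrows. -/
@[reducible]
def DGPro.hcomp (P : DGPro F X Y) (Q : DGPro F Y Z) : DGPro F X Z where
  base := D.hcomp P.base Q.base
  fiber := (F.lax P.base Q.base).hom.toFunctor.obj (P.pair Q)
  src := (cat_obj_of_eq (dg_lax_l P.base Q.base) (P.pair Q)).trans P.src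
  tgt := (cat_obj_of_eq (dg_lax_r P.base Q.base) (P.pair Q)).trans Q.tgt

theorem dg_compat {P : DGPro F X Y} {Q : DGPro F Y Z} {P' : DGPro F X' Y'} {Q' : DGPro F Y' Z'}
    {α : DGCell P P'} {β : DGCell Q Q'} (h : α.right = β.left) :
    (F.pro P'.base).r.toFunctor.map α.fiber ≍ (F.pro Q'.base).l.toFunctor.map β.fiber := by
  have h1 := Grothendieck.congr h
  dsimp only at h1
  have h2 := heq_of_eq h1
  simpa only [eqToHom_comp_heq_iff, comp_eqToHom_heq_iff, heq_eqToHom_comp_iff,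
    heq_comp_eqToHom_iff] using h2

theorem dg_compat_obj {P : DGPro F X Y} {Q : DGPro F Y Z} {P' : DGPro F X' Y'} {Q' : DGPro F Y' Z'}
    {α : D.Cell P.base P'.base} {β : D.Cell Q.base Q'.base} (h : D.right α = D.left β) :
    (F.pro P'.base).r.toFunctor.obj ((F.cell α).hom.toFunctor.obj P.fiber) =
      (F.pro Q'.base).l.toFunctor.obj ((F.cell β).hom.toFunctor.obj Q.fiber) := by
  rw [dg_right_obj α, dg_left_obj β, h]

/-- The image of a pair of composable decorations under a pair of composable cells. -/
@[reducible]
def DGPro.mapPair {P : DGPro F X Y} {Q : DGPro F Y Z} {P' : DGPro F X' Y'} {Q' : DGPro F Y' Z'}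
    (α : D.Cell P.base P'.base) (β : D.Cell Q.base Q'.base) (h : D.right α = D.left β) :
    CatPB (F.pro P'.base).r.toFunctor (F.pro Q'.base).l.toFunctor :=
  ⟨(F.cell α).hom.toFunctor.obj P.fiber, (F.cell β).hom.toFunctor.obj Q.fiber, dg_compat_obj h⟩

/-- The pair of morphisms of decorations `(μ, ν)` as a morphism of the pullback. -/
@[reducible]
def DGCell.pair {P : DGPro F X Y} {Q : DGPro F Y Z} {P' : DGPro F X' Y'} {Q' : DGPro F Y' Z'}
    (α : DGCell P P') (β : DGCell Q Q') (h : α.right = β.left) :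
    DGPro.mapPair α.base β.base (congrArg Grothendieck.Hom.base h) ⟶ P'.pair Q' :=
  ⟨α.fiber, β.fiber, dg_compat h⟩

theorem dg_lax_naturality {a b c a' b' c' : D.Obj} {m : D.Pro a b} {n : D.Pro b c} {m' : D.Pro a' b'}
    {n' : D.Pro b' c'} (α : D.Cell m m') (β : D.Cell n n') (h : D.right α = D.left β) :
    (F.lax m n).hom ≫ (F.cell (D.hcompCell α β h)).hom =
      ((spanData Cat.{v, u}).hcompCell (F.cell α) (F.cell β) (F.cell_compat h)).hom ≫
        (F.lax m' n').hom :=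
  congrArg SpnHom.hom (F.lax_naturality α β h (F.cell_compat h))

theorem dg_hcomp_obj {P : DGPro F X Y} {Q : DGPro F Y Z} {P' : DGPro F X' Y'} {Q' : DGPro F Y' Z'}
    (α : D.Cell P.base P'.base) (β : D.Cell Q.base Q'.base) (h : D.right α = D.left β) :
    (F.cell (D.hcompCell α β h)).hom.toFunctor.obj (P.hcomp Q).fiber =
      (F.lax P'.base Q'.base).hom.toFunctor.obj (DGPro.mapPair α β h) :=
  cat_obj_of_eq (dg_lax_naturality α β h) (P.pair Q)

/-- External composition of cells. -/
@[reducible]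
def DGCell.hcomp {P : DGPro F X Y} {Q : DGPro F Y Z} {P' : DGPro F X' Y'} {Q' : DGPro F Y' Z'}
    (α : DGCell P P') (β : DGCell Q Q') (h : α.right = β.left) :
    DGCell (P.hcomp Q) (P'.hcomp Q') where
  base := D.hcompCell α.base β.base (congrArg Grothendieck.Hom.base h)
  fiber := eqToHom (dg_hcomp_obj α.base β.base (congrArg Grothendieck.Hom.base h)) ≫
    (F.lax P'.base Q'.base).hom.toFunctor.map (α.pair β h)

variable (F) in
/-- The data of the double Grothendieck construction of a lax double functor into spans of
categories. -/
@[reducible]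
def dgData : DoubleData where
  Obj := Grothendieck (dgBase F)
  Pro := DGPro F
  Cell := DGCell
  left := DGCell.left
  right := DGCell.right
  vid := DGCell.vid
  vcomp := DGCell.vcomp
  hid := DGPro.hid
  hidCell := DGCell.hid
  hcomp := DGPro.hcomp
  hcompCell := DGCell.hcomp


theorem dg_comp_eqToHom {P : DGPro F X Y} {Q : DGPro F Z W} {R : DGPro F X' Y'}
    (α : D.Cell P.base Q.base) (β : D.Cell Q.base R.base)
    (p : (F.cell α).hom.toFunctor.obj P.fiber = Q.fiber)
    (q : (F.cell β).hom.toFunctor.obj Q.fiber = R.fiber) :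
    (F.cell (D.vcomp α β)).hom.toFunctor.obj P.fiber = R.fiber := by
  rw [cat_obj_of_eq (dg_cell_vcomp α β), ← q, ← p]; rfl

/-- A cell of the base that transports the decoration of `P` to that of `Q`, with the identity as
morphism of decorations. -/
@[reducible]
def DGCell.ofEq {P : DGPro F X Y} {Q : DGPro F Z W} (α : D.Cell P.base Q.base)
    (p : (F.cell α).hom.toFunctor.obj P.fiber = Q.fiber) : DGCell P Q := ⟨α, eqToHom p⟩

theorem DGCell.ofEq_vcomp {P : DGPro F X Y} {Q : DGPro F Z W} {R : DGPro F X' Y'}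
    (α : D.Cell P.base Q.base) (β : D.Cell Q.base R.base)
    (p : (F.cell α).hom.toFunctor.obj P.fiber = Q.fiber)
    (q : (F.cell β).hom.toFunctor.obj Q.fiber = R.fiber) :
    (DGCell.ofEq α p).vcomp (DGCell.ofEq β q) =
      DGCell.ofEq (D.vcomp α β) (dg_comp_eqToHom α β p q) := by
  refine DGCell.ext_heq rfl (heq_of_eq ?_)
  simp [eqToHom_map]

theorem catPB_eqToHom_fst {C : Type u} [Category.{v} C] {C' : Type u} [Category.{v} C'] {S : Type u}
    [Category.{v} S] {F : C ⥤ S} {G : C' ⥤ S} {X Y : CatPB F G} (h : X = Y) :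
    CatPB.Hom.fst (eqToHom h) = eqToHom (congrArg CatPB.fst h) := by
  subst h; rfl

theorem catPB_eqToHom_snd {C : Type u} [Category.{v} C] {C' : Type u} [Category.{v} C'] {S : Type u}
    [Category.{v} S] {F : C ⥤ S} {G : C' ⥤ S} {X Y : CatPB F G} (h : X = Y) :
    CatPB.Hom.snd (eqToHom h) = eqToHom (congrArg CatPB.snd h) := by
  subst h; rfl

theorem dg_pair_eq {P : DGPro F X Y} {Q : DGPro F Y Z} {P' : DGPro F X' Y'} {Q' : DGPro F Y' Z'}
    {α : D.Cell P.base P'.base} {β : D.Cell Q.base Q'.base}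
    (p : (F.cell α).hom.toFunctor.obj P.fiber = P'.fiber)
    (q : (F.cell β).hom.toFunctor.obj Q.fiber = Q'.fiber) (h : D.right α = D.left β) :
    DGPro.mapPair α β h = P'.pair Q' := CatPB.ext p q

theorem DGCell.ofEq_hcomp {P : DGPro F X Y} {Q : DGPro F Y Z} {P' : DGPro F X' Y'}
    {Q' : DGPro F Y' Z'} (α : D.Cell P.base P'.base) (β : D.Cell Q.base Q'.base)
    (p : (F.cell α).hom.toFunctor.obj P.fiber = P'.fiber)
    (q : (F.cell β).hom.toFunctor.obj Q.fiber = Q'.fiber)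
    (h : (DGCell.ofEq α p).right = (DGCell.ofEq β q).left) :
    (DGCell.ofEq α p).hcomp (DGCell.ofEq β q) h =
      DGCell.ofEq (P := P.hcomp Q) (Q := P'.hcomp Q')
        (D.hcompCell α β (congrArg Grothendieck.Hom.base h))
        ((dg_hcomp_obj α β (congrArg Grothendieck.Hom.base h)).trans
          (congrArg (F.lax P'.base Q'.base).hom.toFunctor.obj
            (dg_pair_eq p q (congrArg Grothendieck.Hom.base h)))) := by
  refine DGCell.ext_heq rfl (heq_of_eq ?_)
  have : (DGCell.ofEq α p).pair (DGCell.ofEq β q) h =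
      eqToHom (dg_pair_eq p q (congrArg Grothendieck.Hom.base h)) :=
    CatPB.Hom.ext
      (catPB_eqToHom_fst (dg_pair_eq p q (congrArg Grothendieck.Hom.base h))).symm
      (catPB_eqToHom_snd (dg_pair_eq p q (congrArg Grothendieck.Hom.base h))).symm
  exact (congrArg (fun k => eqToHom _ ≫ (F.lax P'.base Q'.base).hom.toFunctor.map k) this).trans
    ((congrArg (fun k => eqToHom _ ≫ k)
      (eqToHom_map (F.lax P'.base Q'.base).hom.toFunctor _)).trans (eqToHom_trans _ _))

theorem DGCell.ofEq_left {P : DGPro F X Y} {Q : DGPro F Z W} (α : D.Cell P.base Q.base)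
    (p : (F.cell α).hom.toFunctor.obj P.fiber = Q.fiber) :
    (DGCell.ofEq α p).left = ⟨D.left α, eqToHom (by rw [← Q.src, ← p, dg_left_obj])⟩ := by
  refine dg_hom_ext rfl (heq_of_eq ?_)
  simp [eqToHom_map]

theorem DGCell.ofEq_right {P : DGPro F X Y} {Q : DGPro F Z W} (α : D.Cell P.base Q.base)
    (p : (F.cell α).hom.toFunctor.obj P.fiber = Q.fiber) :
    (DGCell.ofEq α p).right = ⟨D.right α, eqToHom (by rw [← Q.tgt, ← p, dg_right_obj])⟩ := by
  refine dg_hom_ext rfl (heq_of_eq ?_)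
  simp [eqToHom_map]

theorem dg_hom_congr {f g : X.base ⟶ Y.base} (h : f = g)
    (p : (F.map f).toFunctor.obj X.fiber = Y.fiber)
    (q : (F.map g).toFunctor.obj X.fiber = Y.fiber) :
    (⟨f, eqToHom p⟩ : Grothendieck.Hom X Y) = ⟨g, eqToHom q⟩ := by
  subst h; rfl

theorem DGCell.ofEq_congr {P : DGPro F X Y} {Q : DGPro F Z W} {α β : D.Cell P.base Q.base}
    (h : α = β) (p : (F.cell α).hom.toFunctor.obj P.fiber = Q.fiber)
    (q : (F.cell β).hom.toFunctor.obj P.fiber = Q.fiber) :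
    DGCell.ofEq α p = DGCell.ofEq β q := by
  subst h; rfl

theorem DGCell.ofEq_left_id {P : DGPro F X Y} {Q : DGPro F X W} (α : D.Cell P.base Q.base)
    (p : (F.cell α).hom.toFunctor.obj P.fiber = Q.fiber) (h : D.left α = 𝟙 X.base) :
    (DGCell.ofEq α p).left = 𝟙 X := by
  rw [DGCell.ofEq_left]
  exact dg_hom_congr h _ _

theorem DGCell.ofEq_right_id {P : DGPro F X Y} {Q : DGPro F W Y} (α : D.Cell P.base Q.base)
    (p : (F.cell α).hom.toFunctor.obj P.fiber = Q.fiber) (h : D.right α = 𝟙 Y.base) :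
    (DGCell.ofEq α p).right = 𝟙 Y := by
  rw [DGCell.ofEq_right]
  exact dg_hom_congr h _ _

/-- A globular isomorphism of the base that transports the decoration of `P` to that of `Q`. -/
@[reducible]
def DGCell.globIso {P Q : DGPro F X Y} (e : D.GlobIso P.base Q.base)
    (p : (F.cell e.hom).hom.toFunctor.obj P.fiber = Q.fiber) : (dgData F).GlobIso P Q where
  hom := DGCell.ofEq e.hom p
  inv := DGCell.ofEq e.inv (by
    rw [← p]
    have := cat_obj_of_eq ((dg_cell_vcomp (F := F) e.hom e.inv).symm.trans
      ((congrArg (fun x => (F.cell x).hom) e.hom_inv).trans (dg_cell_vid _))) P.fiber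
    exact this)
  left_hom := DGCell.ofEq_left_id _ _ e.left_hom
  right_hom := DGCell.ofEq_right_id _ _ e.right_hom
  hom_inv := (DGCell.ofEq_vcomp _ _ _ _).trans (DGCell.ofEq_congr e.hom_inv _ _)
  inv_hom := (DGCell.ofEq_vcomp _ _ _ _).trans (DGCell.ofEq_congr e.inv_hom _ _)

theorem heq_of_eqToHom_conj {C : Type u} [Category.{v} C] {X Y Z W : C} (p : X = Y) (f : Y ⟶ Z)
    (q : Z = W) : eqToHom p ≫ f ≫ eqToHom q ≍ f := by
  subst p q; simp

theorem DGCell.left_vcomp {P : DGPro F X Y} {Q : DGPro F Z W} {R : DGPro F X' Y'} (α : DGCell P Q)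
    (β : DGCell Q R) : (α.vcomp β).left = α.left ≫ β.left := by
  refine dg_hom_ext (DoubleCategory.left_vcomp α.base β.base) ?_
  refine (heq_of_eqToHom_conj _ _ _).trans ?_
  refine HEq.trans ?_ (eqToHom_comp_heq _ _).symm
  simp only [Functor.map_comp, eqToHom_map]
  refine (eqToHom_comp_heq _ _).trans ?_
  simp only [Category.assoc]
  refine HEq.trans ?_ (eqToHom_comp_heq _ _).symm
  refine heq_comp_of_heq (cat_obj_of_eq (dg_cell_l β.base) _)
    (cat_obj_of_eq (dg_cell_l β.base) _) R.src
    (heq_map_of_cat_eq (dg_cell_l β.base) α.fiber) ?_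
  refine HEq.trans ?_ (eqToHom_comp_heq _ _).symm
  refine HEq.trans ?_ (eqToHom_comp_heq _ _).symm
  exact (comp_eqToHom_heq _ _).symm

theorem DGCell.right_vcomp {P : DGPro F X Y} {Q : DGPro F Z W} {R : DGPro F X' Y'} (α : DGCell P Q)
    (β : DGCell Q R) : (α.vcomp β).right = α.right ≫ β.right := by
  refine dg_hom_ext (DoubleCategory.right_vcomp α.base β.base) ?_
  refine (heq_of_eqToHom_conj _ _ _).trans ?_
  refine HEq.trans ?_ (eqToHom_comp_heq _ _).symm
  simp only [Functor.map_comp, eqToHom_map]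
  refine (eqToHom_comp_heq _ _).trans ?_
  simp only [Category.assoc]
  refine HEq.trans ?_ (eqToHom_comp_heq _ _).symm
  refine heq_comp_of_heq (cat_obj_of_eq (dg_cell_r β.base) _)
    (cat_obj_of_eq (dg_cell_r β.base) _) R.tgt
    (heq_map_of_cat_eq (dg_cell_r β.base) α.fiber) ?_
  refine HEq.trans ?_ (eqToHom_comp_heq _ _).symm
  refine HEq.trans ?_ (eqToHom_comp_heq _ _).symm
  exact (comp_eqToHom_heq _ _).symm

theorem DGCell.vid_vcomp {P : DGPro F X Y} {Q : DGPro F Z W} (α : DGCell P Q) :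
    (DGCell.vid P).vcomp α = α := by
  refine DGCell.ext_heq (DoubleCategory.vid_vcomp α.base) ?_
  refine (eqToHom_comp_heq _ _).trans ?_
  rw [eqToHom_map]
  exact eqToHom_comp_heq _ _

theorem DGCell.vcomp_vid {P : DGPro F X Y} {Q : DGPro F Z W} (α : DGCell P Q) :
    α.vcomp (DGCell.vid Q) = α := by
  refine DGCell.ext_heq (DoubleCategory.vcomp_vid α.base) ?_
  refine (eqToHom_comp_heq _ _).trans
    ((comp_eqToHom_heq _ (cat_obj_of_eq (dg_cell_vid Q.base) Q.fiber)).trans ?_)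
  exact heq_map_of_cat_eq (dg_cell_vid Q.base) α.fiber

theorem DGCell.vcomp_assoc {P : DGPro F X Y} {Q : DGPro F Z W} {R : DGPro F X' Y'}
    {S : DGPro F Z' W'} (α : DGCell P Q) (β : DGCell Q R) (γ : DGCell R S) :
    (α.vcomp β).vcomp γ = α.vcomp (β.vcomp γ) := by
  refine DGCell.ext_heq (DoubleCategory.vcomp_assoc α.base β.base γ.base) ?_
  refine (eqToHom_comp_heq _ _).trans (HEq.trans ?_ (eqToHom_comp_heq _ _).symm)
  dsimp only
  simp only [Functor.map_comp, eqToHom_map, Category.assoc]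
  refine (eqToHom_comp_heq _ _).trans ?_
  refine heq_comp_of_heq (cat_obj_of_eq (dg_cell_vcomp β.base γ.base) _).symm
    (cat_obj_of_eq (dg_cell_vcomp β.base γ.base) _).symm rfl
    (heq_map_of_cat_eq (dg_cell_vcomp β.base γ.base) α.fiber).symm (eqToHom_comp_heq _ _).symm

theorem DGCell.left_hid (f : X ⟶ Y) : (DGCell.hid f).left = f := by
  refine dg_hom_ext (DoubleCategory.left_hidCell f.base) ?_
  refine (heq_of_eqToHom_conj _ _ _).trans ?_
  rw [Functor.map_comp, eqToHom_map]
  exact (eqToHom_comp_heq _ _).trans (heq_map_of_cat_eq (dg_unit_l _) f.fiber)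

theorem DGCell.right_hid (f : X ⟶ Y) : (DGCell.hid f).right = f := by
  refine dg_hom_ext (DoubleCategory.right_hidCell f.base) ?_
  refine (heq_of_eqToHom_conj _ _ _).trans ?_
  rw [Functor.map_comp, eqToHom_map]
  exact (eqToHom_comp_heq _ _).trans (heq_map_of_cat_eq (dg_unit_r _) f.fiber)

theorem DGCell.hid_id (X : Grothendieck (dgBase F)) :
    DGCell.hid (𝟙 X) = DGCell.vid (DGPro.hid X) := by
  refine DGCell.ext_heq (DoubleCategory.hidCell_id X.base) ?_
  refine (eqToHom_comp_heq _ _).trans ?_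
  rw [Grothendieck.id_fiber, eqToHom_map]
  refine heq_eqToHom _ (cat_obj_of_eq (dg_cell_vid _) _) ?_
  exact (congrArg (F.unit X.base).hom.toFunctor.obj
    (cat_obj_of_eq (F.functorial.map_id X.base) X.fiber)).trans
    (cat_obj_of_eq (dg_cell_vid (D.hid X.base)) _).symm

theorem DGCell.hid_comp (f : X ⟶ Y) (g : Y ⟶ Z) :
    DGCell.hid (f ≫ g) = (DGCell.hid f).vcomp (DGCell.hid g) := by
  refine DGCell.ext_heq (DoubleCategory.hidCell_comp f.base g.base) ?_
  refine (eqToHom_comp_heq _ _).trans (HEq.trans ?_ (eqToHom_comp_heq _ _).symm)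
  dsimp only
  rw [Grothendieck.comp_fiber]
  simp only [Functor.map_comp, eqToHom_map, Category.assoc]
  refine (eqToHom_comp_heq _ _).trans (HEq.trans ?_ (eqToHom_comp_heq _ _).symm)
  exact heq_comp_of_heq (cat_obj_of_eq (dg_unit_naturality g.base) _).symm
    (cat_obj_of_eq (dg_unit_naturality g.base) _).symm rfl
    (heq_map_of_cat_eq (dg_unit_naturality g.base) f.fiber).symm (eqToHom_comp_heq _ _).symm

theorem DGCell.left_hcomp {P : DGPro F X Y} {Q : DGPro F Y Z} {P' : DGPro F X' Y'}
    {Q' : DGPro F Y' Z'} (α : DGCell P P') (β : DGCell Q Q') (h : α.right = β.left) :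
    (α.hcomp β h).left = α.left := by
  refine dg_hom_ext (DoubleCategory.left_hcompCell α.base β.base _) ?_
  refine (heq_of_eqToHom_conj _ _ _).trans (HEq.trans ?_ (heq_of_eqToHom_conj _ _ _).symm)
  rw [Functor.map_comp, eqToHom_map]
  exact (eqToHom_comp_heq _ _).trans (heq_map_of_cat_eq (dg_lax_l _ _) (α.pair β h))

theorem DGCell.right_hcomp {P : DGPro F X Y} {Q : DGPro F Y Z} {P' : DGPro F X' Y'}
    {Q' : DGPro F Y' Z'} (α : DGCell P P') (β : DGCell Q Q') (h : α.right = β.left) :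
    (α.hcomp β h).right = β.right := by
  refine dg_hom_ext (DoubleCategory.right_hcompCell α.base β.base _) ?_
  refine (heq_of_eqToHom_conj _ _ _).trans (HEq.trans ?_ (heq_of_eqToHom_conj _ _ _).symm)
  rw [Functor.map_comp, eqToHom_map]
  exact (eqToHom_comp_heq _ _).trans (heq_map_of_cat_eq (dg_lax_r _ _) (α.pair β h))

theorem DGCell.hcomp_vid (P : DGPro F X Y) (Q : DGPro F Y Z) 
    (h : (DGCell.vid P).right = (DGCell.vid Q).left) :
    (DGCell.vid P).hcomp (DGCell.vid Q) h = DGCell.vid (P.hcomp Q) :=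
  (DGCell.ofEq_hcomp _ _ _ _ _).trans (DGCell.ofEq_congr (DoubleCategory.hcompCell_vid _ _) _ _)

theorem DGCell.hcomp_vcomp {P : DGPro F X Y} {Q : DGPro F Y Z} {P' : DGPro F X' Y'}
    {Q' : DGPro F Y' Z'} {P'' : DGPro F X'' Y''}
    {Q'' : DGPro F Y'' Z''} (α : DGCell P P') (β : DGCell Q Q') (α' : DGCell P' P'')
    (β' : DGCell Q' Q'') (h : α.right = β.left) (h' : α'.right = β'.left)
    (H : (α.vcomp α').right = (β.vcomp β').left) :
    (α.vcomp α').hcomp (β.vcomp β') H = (α.hcomp β h).vcomp (α'.hcomp β' h') := by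
  refine DGCell.ext_heq (DoubleCategory.hcompCell_vcomp _ _ _ _ (congrArg Grothendieck.Hom.base h)
    (congrArg Grothendieck.Hom.base h')) ?_
  refine (eqToHom_comp_heq _ _).trans (HEq.trans ?_ (eqToHom_comp_heq _ _).symm)
  have hb := congrArg Grothendieck.Hom.base h
  have hb' := congrArg Grothendieck.Hom.base h'
  let K := ((spanData Cat.{v, u}).hcompCell (F.cell α'.base) (F.cell β'.base)
    (F.cell_compat hb')).hom
  have e : DGPro.mapPair (P := P) (Q := Q) (P' := P'') (Q' := Q'') (α.vcomp α').base (β.vcomp β').base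
      (congrArg Grothendieck.Hom.base H) = K.toFunctor.obj (DGPro.mapPair α.base β.base hb) :=
    CatPB.ext (cat_obj_of_eq (dg_cell_vcomp α.base α'.base) _)
      (cat_obj_of_eq (dg_cell_vcomp β.base β'.base) _)
  have key : (α.vcomp α').pair (β.vcomp β') H ≍
      K.toFunctor.map (α.pair β h) ≫ α'.pair β' h' :=
    CatPB.hom_heq e rfl
      (eqToHom_comp_heq ((F.cell α'.base).hom.toFunctor.map α.fiber ≫ α'.fiber)
        (cat_obj_of_eq (dg_cell_vcomp α.base α'.base) P.fiber))
      (eqToHom_comp_heq ((F.cell β'.base).hom.toFunctor.map β.fiber ≫ β'.fiber)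
        (cat_obj_of_eq (dg_cell_vcomp β.base β'.base) Q.fiber))
  refine (heq_map_of_heq (C := CatPB (F.pro P''.base).r.toFunctor (F.pro Q''.base).l.toFunctor)
    (F.lax P''.base Q''.base).hom.toFunctor e rfl key).trans ?_
  refine (heq_of_eq ((F.lax P''.base Q''.base).hom.toFunctor.map_comp (K.toFunctor.map (α.pair β h))
    (α'.pair β' h'))).trans ?_
  refine heq_comp_of_heq ?_ ?_ rfl ?_ (eqToHom_comp_heq _ _).symm
  · refine (cat_obj_of_eq (dg_lax_naturality α'.base β'.base hb') _).symm.trans ?_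
    exact congrArg (F.cell (D.hcompCell α'.base β'.base hb')).hom.toFunctor.obj
      (dg_hcomp_obj α.base β.base hb).symm
  · exact (cat_obj_of_eq (dg_lax_naturality α'.base β'.base hb') _).symm
  · refine (heq_map_of_cat_eq (dg_lax_naturality α'.base β'.base hb') (α.pair β h)).symm.trans ?_
    exact heq_map_of_heq (F.cell (D.hcompCell α'.base β'.base hb')).hom.toFunctor
      (dg_hcomp_obj α.base β.base hb).symm rfl (eqToHom_comp_heq _ _).symm

theorem dg_assoc_obj (P : DGPro F X Y) (Q : DGPro F Y Z) (R : DGPro F Z W) :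
    (F.cell (DoubleCategory.associator P.base Q.base R.base).hom).hom.toFunctor.obj
      ((P.hcomp Q).hcomp R).fiber = (P.hcomp (Q.hcomp R)).fiber :=
  cat_obj_of_eq (congrArg SpnHom.hom (F.lax_associativity P.base Q.base R.base))
    (⟨P.pair Q, R.fiber, Q.tgt.trans R.src.symm⟩ : CatPB _ _)

theorem dg_left_unit_obj (P : DGPro F X Y) :
    (F.cell (DoubleCategory.leftUnitor P.base).hom).hom.toFunctor.obj
      ((DGPro.hid X).hcomp P).fiber = P.fiber :=
  cat_obj_of_eq (congrArg SpnHom.hom (F.lax_left_unitality P.base))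
    (⟨X.fiber, P.fiber, P.src.symm⟩ : CatPB _ _)

theorem dg_right_unit_obj (P : DGPro F X Y) :
    (F.cell (DoubleCategory.rightUnitor P.base).hom).hom.toFunctor.obj
      (P.hcomp (DGPro.hid Y)).fiber = P.fiber :=
  cat_obj_of_eq (congrArg SpnHom.hom (F.lax_right_unitality P.base))
    (⟨P.fiber, Y.fiber, P.tgt⟩ : CatPB _ _)

theorem dg_assoc_naturality {P : DGPro F X Y} {Q : DGPro F Y Z} {R : DGPro F Z W}
    {P' : DGPro F X' Y'} {Q' : DGPro F Y' Z'} {R' : DGPro F Z' W'} (α : DGCell P P')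
    (β : DGCell Q Q') (γ : DGCell R R') (h : α.right = β.left) (k : β.right = γ.left)
    (h' : (α.hcomp β h).right = γ.left) (k' : α.right = (β.hcomp γ k).left) :
    ((α.hcomp β h).hcomp γ h').vcomp
      (DGCell.ofEq (DoubleCategory.associator P'.base Q'.base R'.base).hom
        (dg_assoc_obj P' Q' R')) =
    (DGCell.ofEq (DoubleCategory.associator P.base Q.base R.base).hom
        (dg_assoc_obj P Q R)).vcomp (α.hcomp (β.hcomp γ k) k') := by
  refine DGCell.ext_heq (DoubleCategory.associator_naturality α.base β.base γ.base
    (congrArg Grothendieck.Hom.base h) (congrArg Grothendieck.Hom.base k)) ?_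
  refine (eqToHom_comp_heq _ _).trans (HEq.trans ?_ (eqToHom_comp_heq _ _).symm)
  have hb := congrArg Grothendieck.Hom.base h
  have kb := congrArg Grothendieck.Hom.base k
  have hb' := congrArg Grothendieck.Hom.base h'
  have kb' := congrArg Grothendieck.Hom.base k'
  let T₀ : CatPB ((spanData Cat.{v, u}).hcomp (F.pro P'.base) (F.pro Q'.base)).r.toFunctor
    (F.pro R'.base).l.toFunctor :=
    ⟨DGPro.mapPair α.base β.base hb, (F.cell γ.base).hom.toFunctor.obj R.fiber, dg_compat_obj kb⟩
  let T₁ : CatPB ((spanData Cat.{v, u}).hcomp (F.pro P'.base) (F.pro Q'.base)).r.toFunctor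
    (F.pro R'.base).l.toFunctor :=
    ⟨P'.pair Q', R'.fiber, Q'.tgt.trans R'.src.symm⟩
  let T : T₀ ⟶ T₁ := ⟨α.pair β h, γ.fiber, dg_compat k⟩
  let L := F.lax P'.base Q'.base
  let M := F.lax Q'.base R'.base
  let G := F.cell (DoubleCategory.associator P'.base Q'.base R'.base).hom
  let K := ((spanData Cat.{v, u}).hcompCell L ((spanData Cat).vid (F.pro R'.base))
    (F.right_lax P'.base Q'.base)).hom
  let N := (DoubleCategory.associator (D := spanData Cat.{v, u}) (F.pro P'.base) (F.pro Q'.base)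
    (F.pro R'.base)).hom.hom ≫ ((spanData Cat.{v, u}).hcompCell ((spanData Cat).vid (F.pro P'.base))
      M (F.left_lax Q'.base R'.base).symm).hom
  have hT : G.hom.toFunctor.map ((F.lax (D.hcomp P'.base Q'.base) R'.base).hom.toFunctor.map
      (K.toFunctor.map T)) ≍ (F.lax P'.base (D.hcomp Q'.base R'.base)).hom.toFunctor.map
      (N.toFunctor.map T) :=
    heq_map_of_cat_eq (congrArg SpnHom.hom (F.lax_associativity P'.base Q'.base R'.base)) T
  have e₁ : DGPro.mapPair (P := P.hcomp Q) (Q := R) (P' := P'.hcomp Q') (Q' := R')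
      (α.hcomp β h).base γ.base hb' = K.toFunctor.obj T₀ :=
    CatPB.ext (dg_hcomp_obj α.base β.base hb) rfl
  have k₁ : (α.hcomp β h).pair γ h' ≍ K.toFunctor.map T :=
    CatPB.hom_heq e₁ rfl (eqToHom_comp_heq (L.hom.toFunctor.map (α.pair β h))
      (dg_hcomp_obj α.base β.base hb)) HEq.rfl
  have e₂ : DGPro.mapPair (P := P) (Q := Q.hcomp R) (P' := P') (Q' := Q'.hcomp R')
      α.base (β.hcomp γ k).base kb' = N.toFunctor.obj T₀ :=
    CatPB.ext rfl (dg_hcomp_obj β.base γ.base kb)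
  have k₂ : α.pair (β.hcomp γ k) k' ≍ N.toFunctor.map T :=
    CatPB.hom_heq e₂ rfl HEq.rfl (eqToHom_comp_heq (M.hom.toFunctor.map (β.pair γ k))
      (dg_hcomp_obj β.base γ.base kb))
  refine (comp_eqToHom_heq _ (dg_assoc_obj P' Q' R')).trans (HEq.trans ?_ (HEq.trans hT ?_))
  · refine heq_map_of_heq G.hom.toFunctor ((dg_hcomp_obj _ _ _).trans (congrArg _ e₁)) rfl
      ((eqToHom_comp_heq _ _).trans ?_)
    exact heq_map_of_heq (F.lax (D.hcomp P'.base Q'.base) R'.base).hom.toFunctor e₁ rfl k₁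
  · refine (heq_map_of_heq (F.lax P'.base (D.hcomp Q'.base R'.base)).hom.toFunctor e₂ rfl k₂).symm.trans ?_
    rw [eqToHom_map]
    refine HEq.trans ?_ (eqToHom_comp_heq _ _).symm
    exact (eqToHom_comp_heq _ _).symm

theorem dg_left_unit_naturality {P : DGPro F X Y} {Q : DGPro F Z W} (α : DGCell P Q)
    (h : (DGCell.hid α.left).right = α.left) :
    ((DGCell.hid α.left).hcomp α h).vcomp (DGCell.ofEq (DoubleCategory.leftUnitor Q.base).hom
        (dg_left_unit_obj Q)) =
    (DGCell.ofEq (DoubleCategory.leftUnitor P.base).hom (dg_left_unit_obj P)).vcomp α := by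
  refine DGCell.ext_heq (DoubleCategory.leftUnitor_naturality α.base) ?_
  refine (eqToHom_comp_heq _ _).trans (HEq.trans ?_ (eqToHom_comp_heq _ _).symm)
  have hb := congrArg Grothendieck.Hom.base h
  let T₀ : CatPB ((spanData Cat.{v, u}).hid (F.obj Z.base)).r.toFunctor
    (F.pro Q.base).l.toFunctor :=
    ⟨(F.map (D.left α.base)).toFunctor.obj X.fiber, (F.cell α.base).hom.toFunctor.obj P.fiber,
      (dg_left_obj α.base).symm⟩
  let T₁ : CatPB ((spanData Cat.{v, u}).hid (F.obj Z.base)).r.toFunctor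
    (F.pro Q.base).l.toFunctor := ⟨Z.fiber, Q.fiber, Q.src.symm⟩
  let T : T₀ ⟶ T₁ := ⟨α.left.fiber, α.fiber, heq_of_eqToHom_conj _ _ _⟩
  let G := F.cell (DoubleCategory.leftUnitor Q.base).hom
  let K := ((spanData Cat.{v, u}).hcompCell (F.unit Z.base) ((spanData Cat).vid (F.pro Q.base))
    (F.right_unit Z.base)).hom
  have hT : G.hom.toFunctor.map ((F.lax (D.hid Z.base) Q.base).hom.toFunctor.map
      (K.toFunctor.map T)) ≍ α.fiber :=
    heq_map_of_cat_eq (congrArg SpnHom.hom (F.lax_left_unitality Q.base)) T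
  have e₁ : DGPro.mapPair (P := DGPro.hid X) (Q := P) (P' := DGPro.hid Z) (Q' := Q)
      (D.hidCell (D.left α.base)) α.base hb = K.toFunctor.obj T₀ :=
    CatPB.ext (cat_obj_of_eq (dg_unit_naturality (D.left α.base)) X.fiber) rfl
  have k₁ : (DGCell.hid α.left).pair α h ≍ K.toFunctor.map T :=
    CatPB.hom_heq e₁ rfl (eqToHom_comp_heq ((F.unit Z.base).hom.toFunctor.map α.left.fiber)
      (cat_obj_of_eq (dg_unit_naturality (D.left α.base)) X.fiber)) HEq.rfl
  refine (comp_eqToHom_heq _ (dg_left_unit_obj Q)).trans (HEq.trans ?_ (HEq.trans hT ?_))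
  · refine heq_map_of_heq G.hom.toFunctor ((dg_hcomp_obj _ _ _).trans (congrArg _ e₁)) rfl
      ((eqToHom_comp_heq _ _).trans ?_)
    exact heq_map_of_heq (F.lax (D.hid Z.base) Q.base).hom.toFunctor e₁ rfl k₁
  · rw [eqToHom_map]
    exact (eqToHom_comp_heq _ _).symm

theorem dg_right_unit_naturality {P : DGPro F X Y} {Q : DGPro F Z W} (α : DGCell P Q)
    (h : α.right = (DGCell.hid α.right).left) :
    (α.hcomp (DGCell.hid α.right) h).vcomp (DGCell.ofEq (DoubleCategory.rightUnitor Q.base).hom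
        (dg_right_unit_obj Q)) =
    (DGCell.ofEq (DoubleCategory.rightUnitor P.base).hom (dg_right_unit_obj P)).vcomp α := by
  refine DGCell.ext_heq (DoubleCategory.rightUnitor_naturality α.base) ?_
  refine (eqToHom_comp_heq _ _).trans (HEq.trans ?_ (eqToHom_comp_heq _ _).symm)
  have hb := congrArg Grothendieck.Hom.base h
  let T₀ : CatPB (F.pro Q.base).r.toFunctor
    ((spanData Cat.{v, u}).hid (F.obj W.base)).l.toFunctor :=
    ⟨(F.cell α.base).hom.toFunctor.obj P.fiber, (F.map (D.right α.base)).toFunctor.obj Y.fiber,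
      dg_right_obj α.base⟩
  let T₁ : CatPB (F.pro Q.base).r.toFunctor
    ((spanData Cat.{v, u}).hid (F.obj W.base)).l.toFunctor := ⟨Q.fiber, W.fiber, Q.tgt⟩
  let T : T₀ ⟶ T₁ := ⟨α.fiber, α.right.fiber, (heq_of_eqToHom_conj _ _ _).symm⟩
  let G := F.cell (DoubleCategory.rightUnitor Q.base).hom
  let K := ((spanData Cat.{v, u}).hcompCell ((spanData Cat).vid (F.pro Q.base)) (F.unit W.base)
    (F.left_unit W.base).symm).hom
  have hT : G.hom.toFunctor.map ((F.lax Q.base (D.hid W.base)).hom.toFunctor.map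
      (K.toFunctor.map T)) ≍ α.fiber :=
    heq_map_of_cat_eq (congrArg SpnHom.hom (F.lax_right_unitality Q.base)) T
  have e₁ : DGPro.mapPair (P := P) (Q := DGPro.hid Y) (P' := Q) (Q' := DGPro.hid W)
      α.base (D.hidCell (D.right α.base)) hb = K.toFunctor.obj T₀ :=
    CatPB.ext rfl (cat_obj_of_eq (dg_unit_naturality (D.right α.base)) Y.fiber)
  have k₁ : α.pair (DGCell.hid α.right) h ≍ K.toFunctor.map T :=
    CatPB.hom_heq e₁ rfl HEq.rfl (eqToHom_comp_heq ((F.unit W.base).hom.toFunctor.map α.right.fiber)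
      (cat_obj_of_eq (dg_unit_naturality (D.right α.base)) Y.fiber))
  refine (comp_eqToHom_heq _ (dg_right_unit_obj Q)).trans (HEq.trans ?_ (HEq.trans hT ?_))
  · refine heq_map_of_heq G.hom.toFunctor ((dg_hcomp_obj _ _ _).trans (congrArg _ e₁)) rfl
      ((eqToHom_comp_heq _ _).trans ?_)
    exact heq_map_of_heq (F.lax Q.base (D.hid W.base)).hom.toFunctor e₁ rfl k₁
  · rw [eqToHom_map]
    exact (eqToHom_comp_heq _ _).symm

variable (F) in
/-- The laws of the double Grothendieck construction. -/
@[reducible]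
def dgLaws : DoubleCategory (dgData F) where
  left_vid P := DGCell.ofEq_left_id _ _ (DoubleCategory.left_vid _)
  right_vid P := DGCell.ofEq_right_id _ _ (DoubleCategory.right_vid _)
  left_vcomp := DGCell.left_vcomp
  right_vcomp := DGCell.right_vcomp
  vid_vcomp := DGCell.vid_vcomp
  vcomp_vid := DGCell.vcomp_vid
  vcomp_assoc := DGCell.vcomp_assoc
  left_hidCell := DGCell.left_hid
  right_hidCell := DGCell.right_hid
  hidCell_id := DGCell.hid_id
  hidCell_comp := DGCell.hid_comp
  left_hcompCell := DGCell.left_hcomp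
  right_hcompCell := DGCell.right_hcomp
  hcompCell_vid P Q := DGCell.hcomp_vid P Q _
  hcompCell_vcomp α β α' β' h h' := DGCell.hcomp_vcomp α β α' β' h h' _
  associator P Q R := DGCell.globIso (DoubleCategory.associator P.base Q.base R.base)
    (dg_assoc_obj P Q R)
  leftUnitor P := DGCell.globIso (DoubleCategory.leftUnitor P.base) (dg_left_unit_obj P)
  rightUnitor P := DGCell.globIso (DoubleCategory.rightUnitor P.base) (dg_right_unit_obj P)
  associator_naturality α β γ h k := dg_assoc_naturality α β γ h k _ _
  leftUnitor_naturality α := dg_left_unit_naturality α _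
  rightUnitor_naturality α := dg_right_unit_naturality α _
  pentagon P Q R S := by
    simp only [DGCell.ofEq_hcomp, DGCell.ofEq_vcomp]
    exact DGCell.ofEq_congr (DoubleCategory.pentagon P.base Q.base R.base S.base) _ _
  triangle P Q := by
    simp only [DGCell.ofEq_hcomp, DGCell.ofEq_vcomp]
    exact DGCell.ofEq_congr (DoubleCategory.triangle P.base Q.base) _ _

end Grothendieck

/-- The double Grothendieck construction of a lax double functor into spans of categories. -/
def DoubleGrothendieck {D : DoubleData.{u₁, v₁, u₂, v₂}} [DoubleCategory D]
    (F : LaxDoubleFunctor D (spanData Cat.{v, u})) : DoubleData := dgData F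

instance dgDoubleCategory {D : DoubleData.{u₁, v₁, u₂, v₂}} [DoubleCategory D]
    (F : LaxDoubleFunctor D (spanData Cat.{v, u})) : DoubleCategory (DoubleGrothendieck F) :=
  dgLaws F

section Projection

variable {D : DoubleData.{u₁, v₁, u₂, v₂}} [DoubleCategory D]

/-- The projection from the double Grothendieck construction to the base. -/
@[reducible]
def dgProj (F : LaxDoubleFunctor D (spanData Cat.{v, u})) : DoubleMap (DoubleGrothendieck F) D where
  obj X := X.base
  map f := f.base
  pro P := P.base
  cell α := α.base

end Projection

/-! ## Decorated cospans -/

section DecoratedCospans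

variable {A : Type u} [Category.{v} A] [HasFiniteColimits A]

/-- A lax monoidal structure on a functor from `(A, +)` to `(Cat, ×)`. -/
abbrev LaxMonoidalToCat (F : A ⥤ Cat.{v₁, u₁}) :=
  letI := monoidalOfHasFiniteCoproducts A
  F.LaxMonoidal

variable (F : A ⥤ Cat.{v₁, u₁})

section Laxators

variable [LaxMonoidalToCat F]

/-- The laxator `F m × F n ⥤ F (m + n)`. -/
def laxator (m n : A) : (F.obj m × F.obj n) ⥤ F.obj (m ⨿ n) :=
  letI := monoidalOfHasFiniteCoproducts A
  (Functor.LaxMonoidal.μ F m n).toFunctor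

/-- The object of `F 0` picked out by the unitor `1 ⥤ F 0`. -/
def unitor : F.obj (⊥_ A) :=
  letI := monoidalOfHasFiniteCoproducts A
  (Functor.LaxMonoidal.ε F).toFunctor.obj ⟨⟨⟨⟩⟩⟩

theorem laxator_naturality {m n m' n' : A} (f : m ⟶ m') (g : n ⟶ n') :
    laxator F m n ⋙ (F.map (coprod.map f g)).toFunctor =
      (F.map f).toFunctor.prod (F.map g).toFunctor ⋙ laxator F m' n' := by
  let := monoidalOfHasFiniteCoproducts A
  exact congrArg (fun h => h.toFunctor) (Functor.LaxMonoidal.μ_natural F f g).symm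

variable {F} {a b c d a' b' c' : A}

variable (F) in
/-- The functor `F m × F n ⥤ F (m + n) ⥤ F (m +_b n)` that composes decorations. -/
noncomputable def Phi (p : Cosp a b) (q : Cosp b c) :
    (F.obj p.apex × F.obj q.apex) ⥤ F.obj (p.comp q).apex :=
  laxator F p.apex q.apex ⋙
    (F.map (coprod.desc (pushout.inl p.r q.l) (pushout.inr p.r q.l))).toFunctor

variable (F) in
/-- The object of `F a` picked out by `1 ⥤ F 0 ⥤ F a`. -/
noncomputable def Phi₀ (a : A) : F.obj a := (F.map (initial.to a)).toFunctor.obj (unitor F)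

theorem Phi_naturality {p : Cosp a b} {q : Cosp b c} {p' : Cosp a' b'} {q' : Cosp b' c'}
    (α : CospHom p p') (β : CospHom q q') (h : α.right = β.left) :
    Phi F p q ⋙ (F.map (α.hcomp β h).hom).toFunctor =
      (F.map α.hom).toFunctor.prod (F.map β.hom).toFunctor ⋙ Phi F p' q' := by
  have e : coprod.desc (pushout.inl p.r q.l) (pushout.inr p.r q.l) ≫ (α.hcomp β h).hom =
      coprod.map α.hom β.hom ≫ coprod.desc (pushout.inl p'.r q'.l) (pushout.inr p'.r q'.l) := by
    apply coprod.hom_ext <;> simp [pushout.inl_desc, pushout.inr_desc]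
  have e' := congrArg (fun k => (F.map k).toFunctor) e
  simp only [F.map_comp] at e'
  exact (congrArg (fun k => laxator F p.apex q.apex ⋙ k) e').trans
    (congrArg (fun k => k ⋙ (F.map (coprod.desc (pushout.inl p'.r q'.l)
      (pushout.inr p'.r q'.l))).toFunctor) (laxator_naturality F α.hom β.hom))

theorem Phi₀_naturality {a b : A} (f : a ⟶ b) : (F.map f).toFunctor.obj (Phi₀ F a) = Phi₀ F b := by
  have e : initial.to a ≫ f = initial.to b := initial.hom_ext _ _
  have e' := congrArg (fun k => (F.map k).toFunctor) e
  simp only [F.map_comp] at e'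
  exact congrArg (fun k => k.obj (unitor F)) e'

end Laxators

/-- Decorated cospans: a cospan and a decoration of its apex. -/
@[ext]
structure DCPro (a b : A) where
  /-- the cospan -/
  base : Cosp a b
  /-- the decoration -/
  fiber : F.obj base.apex

variable {F} {a b c d a' b' c' d' : A}

/-- Morphisms of decorated cospans: a morphism of cospans and a decoration morphism. -/
structure DCCell (P : DCPro F a b) (Q : DCPro F c d) where
  /-- the morphism of cospans -/
  base : CospHom P.base Q.base
  /-- the decoration morphism -/
  fiber : (F.map base.hom).toFunctor.obj P.fiber ⟶ Q.fiber

/-- The internal identity on a decorated cospan. -/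
@[reducible]
def DCCell.vid (P : DCPro F a b) : DCCell P P where
  base := CospHom.id P.base
  fiber := eqToHom (cat_obj_of_eq (F.map_id P.base.apex) P.fiber)

/-- Internal composition of morphisms of decorated cospans. -/
@[reducible]
def DCCell.vcomp {P : DCPro F a b} {Q : DCPro F c d} {R : DCPro F a' b'} (α : DCCell P Q)
    (β : DCCell Q R) : DCCell P R where
  base := α.base.comp β.base
  fiber := eqToHom (cat_obj_of_eq (F.map_comp α.base.hom β.base.hom) P.fiber) ≫
    (F.map β.base.hom).toFunctor.map α.fiber ≫ β.fiber

variable [LaxMonoidalToCat F]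

variable (F) in
/-- The identity decorated cospan. -/
@[reducible]
noncomputable def DCPro.hid (a : A) : DCPro F a a where
  base := Cosp.id a
  fiber := Phi₀ F a

variable (F) in
/-- The external identity on an arrow. -/
@[reducible]
noncomputable def DCCell.hid (f : a ⟶ b) : DCCell (DCPro.hid F a) (DCPro.hid F b) where
  base := CospHom.hid f
  fiber := eqToHom (Phi₀_naturality f)

/-- External composition of decorated cospans. -/
@[reducible]
noncomputable def DCPro.hcomp (P : DCPro F a b) (Q : DCPro F b c) : DCPro F a c where
  base := P.base.comp Q.base
  fiber := (Phi F P.base Q.base).obj (P.fiber, Q.fiber)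

/-- External composition of morphisms of decorated cospans. -/
@[reducible]
noncomputable def DCCell.hcomp {P : DCPro F a b} {Q : DCPro F b c} {P' : DCPro F a' b'}
    {Q' : DCPro F b' c'} (α : DCCell P P') (β : DCCell Q Q') (h : α.base.right = β.base.left) :
    DCCell (P.hcomp Q) (P'.hcomp Q') where
  base := α.base.hcomp β.base h
  fiber := eqToHom (congrArg (fun k => k.obj (P.fiber, Q.fiber))
      (Phi_naturality α.base β.base h)) ≫
    (Phi F P'.base Q'.base).map (α.fiber, β.fiber)

variable (F)

/-- The data of the double category of decorated cospans. -/
@[reducible]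
noncomputable def dcspData : DoubleData where
  Obj := A
  Pro a b := DCPro F a b
  Cell P Q := DCCell P Q
  left α := α.base.left
  right α := α.base.right
  vid := DCCell.vid
  vcomp := DCCell.vcomp
  hid := DCPro.hid F
  hidCell := DCCell.hid F
  hcomp := DCPro.hcomp
  hcompCell := DCCell.hcomp

/-- The projection from decorated cospans to cospans. -/
@[reducible]
noncomputable def dcspProj : DoubleMap (dcspData F) (cspData A) where
  obj a := a
  map f := f
  pro P := P.base
  cell α := α.base

/-- The composite of the lax double functors from cospans in `A` to `(A, +)`, from `(A, +)` to
`(Cat, ×)`, and from `(Cat, ×)` to spans of categories. -/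
noncomputable def decorationFunctor : LaxDoubleFunctor (cspData A) (spanData Cat.{v₁, u₁}) :=
  letI := monoidalOfHasFiniteCoproducts A
  ((apexCsp A).comp (monMap F)).comp (apexSpan Cat)

/-- The comparison from decorated cospans to the double Grothendieck construction, which equips
objects and arrows with the unique object and morphism of the terminal category. -/
@[reducible]
noncomputable def dcspCompare : DoubleMap (dcspData F) (DoubleGrothendieck (decorationFunctor F)) where
  obj a := ⟨a, ⟨⟨⟨⟩⟩⟩⟩
  map f := ⟨f, 𝟙 _⟩
  pro P := ⟨P.base, P.fiber, rfl, rfl⟩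
  cell α := ⟨α.base, α.fiber⟩

end DecoratedCospans

end Dbl

/-!
Decorated cospans inherit their double category structure from the double Grothendieck construction
`∫ F̃` of the composite lax double functor `F̃ : Csp A ⟶ (A, +) ⟶ (Cat, ×) ⟶ Span Cat`.

Since `F̃` sends every object of `A` to the terminal category, an object or arrow of `∫ F̃` is an
object or arrow of `A`, with a decoration that carries no information (`decoration_hom_ext`), and the
conditions on the source and target of the decoration of a proarrow hold automatically. The apex of
`F̃ p` is `F m`, where `m` is the apex of `p`, and the laxator of `F̃` at `p`, `q`, evaluated on a pair
of decorations, is `Phi F p q`. Hence the comparison map from decorated cospans to `∫ F̃` is bijective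
and respects all operations. On proarrows and cells it does so definitionally (which the proofs use
silently when they apply `DCCell.eq_of_toDG`), except for the external identity cell of an arrow,
whose decoration in `∫ F̃` is the image of an identity morphism under the unitor and not an identity
morphism itself (`DCCell.toDG_hid`).

Every law of decorated cospans is therefore the preimage of the same law of `∫ F̃`, and associators
and unitors are the preimages of those of `∫ F̃` (`dcspDoubleCategory`). With this choice the
comparison is a strict double functor. The projection to cospans is strict because the associators
and unitors of `∫ F̃` lie over those of cospans.
-/

namespace Dbl

theorem DGCell.hcomp_congr {D : DoubleData.{u₁, v₁, u₂, v₂}} [DoubleCategory D]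
    {G : LaxDoubleFunctor D (spanData Cat.{v, u})} {X Y Z X' Y' Z' : Grothendieck (dgBase G)}
    {P : DGPro G X Y} {Q : DGPro G Y Z} {P' : DGPro G X' Y'} {Q' : DGPro G Y' Z'}
    {α α' : DGCell P P'} {β β' : DGCell Q Q'} (hα : α = α') (hβ : β = β')
    (h : α.right = β.left) (h' : α'.right = β'.left) : α.hcomp β h = α'.hcomp β' h' := by
  subst hα hβ; rfl

section DecoratedCospanLaws

variable {A : Type u} [Category.{v} A] [HasFiniteColimits A] {F : A ⥤ Cat.{v₁, u₁}}
  [LaxMonoidalToCat F] {a b c d a' b' c' d' : A}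

/-- A decorated cospan as a proarrow of the double Grothendieck construction. -/
noncomputable abbrev DCPro.toDG (P : DCPro F a b) :
    DGPro (decorationFunctor F) ((dcspCompare F).obj a) ((dcspCompare F).obj b) :=
  (dcspCompare F).pro P

/-- A morphism of decorated cospans as a cell of the double Grothendieck construction. -/
noncomputable abbrev DCCell.toDG {P : DCPro F a b} {Q : DCPro F c d} (α : DCCell P Q) :
    DGCell P.toDG Q.toDG :=
  (dcspCompare F).cell α

/-- The inverse of the comparison on cells. -/
def DCCell.ofDG {P : DCPro F a b} {Q : DCPro F c d} (α : DGCell P.toDG Q.toDG) : DCCell P Q :=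
  ⟨α.base, α.fiber⟩

/-- The comparison is injective on cells. As it commutes definitionally with internal identities and
with internal and external composition of cells, this carries a law of the double Grothendieck
construction back to decorated cospans. -/
theorem DCCell.eq_of_toDG {P : DCPro F a b} {Q : DCPro F c d} {α β : DCCell P Q}
    (h : α.toDG = β.toDG) : α = β :=
  congrArg DCCell.ofDG h

/-- Arrows of the double Grothendieck construction over a given arrow of `A` are unique, since the
decorations of objects form the terminal category. -/
theorem decoration_hom_ext {X Y : Grothendieck (dgBase (decorationFunctor F))} {f g : X ⟶ Y}
    (h : f.base = g.base) : f = g :=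
  dg_hom_ext h (by
    obtain ⟨f, x⟩ := f
    obtain ⟨g, y⟩ := g
    obtain rfl : f = g := h
    exact heq_of_eq (ULift.ext _ _ (Subsingleton.elim _ _)))

theorem DCCell.toDG_right_eq_left {P : DCPro F a b} {Q : DCPro F b c} {P' : DCPro F a' b'}
    {Q' : DCPro F b' c'} {α : DCCell P P'} {β : DCCell Q Q'} (h : α.base.right = β.base.left) :
    α.toDG.right = β.toDG.left :=
  decoration_hom_ext h

/-- The decoration of the right-hand side is the image of an identity morphism under the unitor, which
is an identity morphism only propositionally. -/
theorem DCCell.toDG_hid (f : a ⟶ b) :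
    (DCCell.hid F f).toDG = DGCell.hid ((dcspCompare F).map f) := by
  refine DGCell.ext_heq rfl (heq_of_eq ?_)
  refine ((Category.comp_id _).symm.trans (congrArg _ ?_))
  exact (((decorationFunctor F).unit b).hom.toFunctor.map_id _).symm

theorem DCCell.toDG_hid_left {P : DCPro F a b} {Q : DCPro F c d} (α : DCCell P Q) :
    (DCCell.hid F α.base.left).toDG = DGCell.hid α.toDG.left :=
  (toDG_hid _).trans (congrArg DGCell.hid (decoration_hom_ext rfl))

theorem DCCell.toDG_hid_right {P : DCPro F a b} {Q : DCPro F c d} (α : DCCell P Q) :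
    (DCCell.hid F α.base.right).toDG = DGCell.hid α.toDG.right :=
  (toDG_hid _).trans (congrArg DGCell.hid (decoration_hom_ext rfl))

/-- Globular isomorphisms of the double Grothendieck construction between decorated cospans are
globular isomorphisms of decorated cospans. -/
@[reducible]
def GlobIso.ofDG {P Q : DCPro F a b} (e : (dgData (decorationFunctor F)).GlobIso P.toDG Q.toDG) :
    (dcspData F).GlobIso P Q where
  hom := DCCell.ofDG e.hom
  inv := DCCell.ofDG e.inv
  left_hom := congrArg Grothendieck.Hom.base e.left_hom
  right_hom := congrArg Grothendieck.Hom.base e.right_hom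
  hom_inv := congrArg DCCell.ofDG e.hom_inv
  inv_hom := congrArg DCCell.ofDG e.inv_hom

variable (F) in
/-- The double category of decorated cospans. The comparison with the double Grothendieck
construction commutes with all operations on cells and is injective on cells, so every law is the
preimage of the corresponding law of the double Grothendieck construction. -/
@[reducible]
noncomputable def dcspDoubleCategory : DoubleCategory (dcspData F) where
  left_vid _ := rfl
  right_vid _ := rfl
  left_vcomp _ _ := rfl
  right_vcomp _ _ := rfl
  vid_vcomp α := DCCell.eq_of_toDG (DGCell.vid_vcomp α.toDG)
  vcomp_vid α := DCCell.eq_of_toDG (DGCell.vcomp_vid α.toDG)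
  vcomp_assoc α β γ := DCCell.eq_of_toDG (DGCell.vcomp_assoc α.toDG β.toDG γ.toDG)
  left_hidCell _ := rfl
  right_hidCell _ := rfl
  hidCell_id a := DCCell.eq_of_toDG ((DCCell.toDG_hid (F := F) (𝟙 a)).trans
    (DGCell.hid_id ((dcspCompare F).obj a)))
  hidCell_comp f g := DCCell.eq_of_toDG ((DCCell.toDG_hid (F := F) (f ≫ g)).trans
    ((congrArg DGCell.hid (decoration_hom_ext rfl)).trans
      ((DGCell.hid_comp ((dcspCompare F).map f) ((dcspCompare F).map g)).trans
        (congrArg₂ DGCell.vcomp (DCCell.toDG_hid f) (DCCell.toDG_hid g)).symm)))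
  left_hcompCell _ _ _ := rfl
  right_hcompCell _ _ _ := rfl
  hcompCell_vid P Q := DCCell.eq_of_toDG
    (DGCell.hcomp_vid P.toDG Q.toDG (decoration_hom_ext rfl))
  hcompCell_vcomp α β α' β' h h' := DCCell.eq_of_toDG
    (DGCell.hcomp_vcomp α.toDG β.toDG α'.toDG β'.toDG (DCCell.toDG_right_eq_left h)
      (DCCell.toDG_right_eq_left h')
      (DCCell.toDG_right_eq_left (α := α.vcomp α') (β := β.vcomp β') (congrArg₂ (· ≫ ·) h h')))
  associator P Q R := GlobIso.ofDG
    ((dgLaws (decorationFunctor F)).associator P.toDG Q.toDG R.toDG)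
  leftUnitor P := GlobIso.ofDG ((dgLaws (decorationFunctor F)).leftUnitor P.toDG)
  rightUnitor P := GlobIso.ofDG ((dgLaws (decorationFunctor F)).rightUnitor P.toDG)
  associator_naturality α β γ h k := DCCell.eq_of_toDG
    (dg_assoc_naturality α.toDG β.toDG γ.toDG (DCCell.toDG_right_eq_left h)
      (DCCell.toDG_right_eq_left k) (decoration_hom_ext k) (decoration_hom_ext h))
  leftUnitor_naturality {_ _ _ _ _ Q} α := DCCell.eq_of_toDG
    ((congrArg (fun β => DGCell.vcomp β ((dgLaws (decorationFunctor F)).leftUnitor Q.toDG).hom)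
      (DGCell.hcomp_congr (DCCell.toDG_hid_left α) rfl (decoration_hom_ext rfl)
        (DGCell.right_hid _))).trans
        (dg_left_unit_naturality α.toDG (DGCell.right_hid _)))
  rightUnitor_naturality {_ _ _ _ _ Q} α := DCCell.eq_of_toDG
    ((congrArg (fun β => DGCell.vcomp β ((dgLaws (decorationFunctor F)).rightUnitor Q.toDG).hom)
      (DGCell.hcomp_congr rfl (DCCell.toDG_hid_right α) (decoration_hom_ext rfl)
        (DGCell.left_hid _).symm)).trans
        (dg_right_unit_naturality α.toDG (DGCell.left_hid _).symm))
  pentagon P Q R S := DCCell.eq_of_toDG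
    ((dgLaws (decorationFunctor F)).pentagon P.toDG Q.toDG R.toDG S.toDG)
  triangle P Q := DCCell.eq_of_toDG
    ((dgLaws (decorationFunctor F)).triangle P.toDG Q.toDG)

theorem dcspCompare_functorial : (dcspCompare F).IsFunctorial where
  map_id _ := decoration_hom_ext rfl
  map_comp _ _ := decoration_hom_ext rfl
  left_cell _ := decoration_hom_ext rfl
  right_cell _ := decoration_hom_ext rfl
  cell_vid _ := rfl
  cell_vcomp _ _ := rfl

theorem dcspProj_isStrict :
    letI := dcspDoubleCategory F
    (dcspProj F).IsStrict :=
  letI := dcspDoubleCategory F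
  { functorial :=
      { map_id := fun _ => rfl
        map_comp := fun _ _ => rfl
        left_cell := fun _ => rfl
        right_cell := fun _ => rfl
        cell_vid := fun _ => rfl
        cell_vcomp := fun _ _ => rfl }
    pro_hid := fun _ => rfl
    cell_hidCell := fun _ => HEq.rfl
    pro_hcomp := fun _ _ => rfl
    cell_hcompCell := fun _ _ _ _ => HEq.rfl
    cell_associator := fun _ _ _ => HEq.rfl
    cell_leftUnitor := fun _ => HEq.rfl
    cell_rightUnitor := fun _ => HEq.rfl }

theorem dcspCompare_isStrict :
    letI := dcspDoubleCategory F
    (dcspCompare F).IsStrict :=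
  letI := dcspDoubleCategory F
  { functorial := dcspCompare_functorial
    pro_hid := fun _ => rfl
    cell_hidCell := fun f => heq_of_eq (DCCell.toDG_hid f)
    pro_hcomp := fun _ _ => rfl
    cell_hcompCell := fun _ _ _ _ => HEq.rfl
    cell_associator := fun _ _ _ => HEq.rfl
    cell_leftUnitor := fun _ => HEq.rfl
    cell_rightUnitor := fun _ => HEq.rfl }

theorem dcspCompare_isIsomorphism :
    letI := dcspDoubleCategory F
    (dcspCompare F).IsIsomorphism :=
  letI := dcspDoubleCategory F
  { strict := dcspCompare_isStrict
    bijective_obj :=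
      ⟨fun _ _ h => congrArg Grothendieck.base h, fun X => ⟨X.base, rfl⟩⟩
    bijective_map := fun _ _ =>
      ⟨fun _ _ h => congrArg Grothendieck.Hom.base h,
        fun f => ⟨f.base, decoration_hom_ext rfl⟩⟩
    bijective_pro := fun _ _ =>
      ⟨fun _ _ h => congrArg (fun R : DGPro (decorationFunctor F) _ _ =>
          (⟨R.base, R.fiber⟩ : DCPro F _ _)) h,
        fun P => ⟨⟨P.base, P.fiber⟩, rfl⟩⟩
    bijective_cell := fun _ _ =>
      ⟨fun _ _ h => congrArg DCCell.ofDG h, fun α => ⟨DCCell.ofDG α, rfl⟩⟩ }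

end DecoratedCospanLaws

end Dbl

/-- Let `A` be a category with finite colimits and `F : (A, +) ⥤ (Cat, ×)` a lax monoidal functor.
Decorated cospans form a double category, in such a way that the projection to cospans in `A` is a
strict double functor and that the comparison with the double Grothendieck construction of the
composite lax double functor `Csp A ⟶ (A, +) ⟶ (Cat, ×) ⟶ Span Cat` is an isomorphism of double
categories over cospans in `A`. -/
theorem mainTheorem4 {A : Type u} [Category.{v} A] [HasFiniteColimits A]
    (F : A ⥤ Cat.{v₁, u₁}) [Dbl.LaxMonoidalToCat F] :
    ∃ _ : Dbl.DoubleCategory (Dbl.dcspData F),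
      (Dbl.dcspProj F).IsStrict ∧
      (Dbl.dcspCompare F).IsIsomorphism ∧
      (Dbl.dcspCompare F).comp (Dbl.dgProj (Dbl.decorationFunctor F)) = Dbl.dcspProj F :=
  ⟨Dbl.dcspDoubleCategory F, Dbl.dcspProj_isStrict, Dbl.dcspCompare_isIsomorphism, rfl⟩
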